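/- Let $\lambda_1>20$ and let $\beta\in[0,1]$ be irrational, with continued fraction expansion $\beta=\cfrac{1}{a_1+\cfrac{1}{a_2+\cdots}}$. Let $H$ be the on-diagonal Sturmian operator on $\ell^2(\mathbb Z)$, $$(H\psi)(n)=\psi(n+1)+\psi(n-1)+\lambda_1\bigl(\lfloor (n+1)\beta\rfloor-\lfloor n\beta\rfloor\bigr)\psi(n),\qquad n\in\mathbb Z,$$ where $\lfloor x\rfloor$ is the largest integer not exceeding $x$, and let $\sigma$ be its spectrum. Put $C_k=\frac3k\sum_{j=1}^k\ln(a_j+2)$ and suppose that $C=\limsup_{k\to\infty}C_k<+\infty$. Then the upper box-counting dimension $\dim_B^+(\sigma)=\limsup_{\varepsilon\to0^+}\frac{\ln N(\varepsilon)}{-\ln\varepsilon}$, where $N(\varepsilon)$ is the minimal number of balls of diameter at most $\varepsilon$ needed to cover $\sigma$, satisfies $$\dim_B^+(\sigma)\ \ge\ \frac{\ln\left(\frac{\sqrt5+1}{2}\right)}{C+\ln(\lambda_1+5)}.$$ -/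

import Mathlib

open Filter Topology
open scoped ENNReal NNReal

noncomputable section

/-- The Hilbert space `ℓ²(ℤ)`. -/
abbrev EllTwo : Type := lp (fun _ : ℤ => ℂ) 2

theorem summable_weightedShift {w : ℤ → ℝ} {M : ℝ} (hM : ∀ n, |w n| ≤ M) (k : ℤ) (ψ : EllTwo) :
    Summable (fun n : ℤ => ‖(w n : ℂ) * ψ (n + k)‖ ^ (2 : ℝ≥0∞).toReal) ∧
      ∑' n : ℤ, ‖(w n : ℂ) * ψ (n + k)‖ ^ (2 : ℝ≥0∞).toReal
        ≤ (M * ‖ψ‖) ^ (2 : ℝ≥0∞).toReal := by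
  have h2 : 0 < (2 : ℝ≥0∞).toReal := by norm_num
  have hM0 : 0 ≤ M := (abs_nonneg _).trans (hM 0)
  have hs : HasSum (fun n : ℤ => ‖ψ (n + k)‖ ^ (2 : ℝ≥0∞).toReal) (‖ψ‖ ^ (2 : ℝ≥0∞).toReal) :=
    (Equiv.addRight k).hasSum_iff.mpr (lp.hasSum_norm h2 ψ)
  have hs' := hs.mul_left (M ^ (2 : ℝ≥0∞).toReal)
  have hle : ∀ n : ℤ, ‖(w n : ℂ) * ψ (n + k)‖ ^ (2 : ℝ≥0∞).toReal ≤
      M ^ (2 : ℝ≥0∞).toReal * ‖ψ (n + k)‖ ^ (2 : ℝ≥0∞).toReal := by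
    intro n
    rw [norm_mul, Complex.norm_real, Real.norm_eq_abs,
      Real.mul_rpow (abs_nonneg _) (norm_nonneg _)]
    have := hM n
    gcongr
  have hsum := Summable.of_nonneg_of_le (fun n => by positivity) hle hs'.summable
  refine ⟨hsum, ?_⟩
  rw [Real.mul_rpow hM0 (norm_nonneg _), ← hs'.tsum_eq]
  exact hsum.tsum_le_tsum hle hs'.summable

/-- For a bounded real sequence `w` and `k : ℤ`, the bounded operator
`(weightedShift w hw k ψ) n = w n * ψ (n + k)` on `ℓ²(ℤ)`. -/
def weightedShift (w : ℤ → ℝ) (hw : ∃ M : ℝ, ∀ n, |w n| ≤ M) (k : ℤ) : EllTwo →L[ℂ] EllTwo :=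
  LinearMap.mkContinuousOfExistsBound
    { toFun := fun ψ => ⟨fun n => (w n : ℂ) * ψ (n + k),
        memℓp_gen (summable_weightedShift hw.choose_spec k ψ).1⟩
      map_add' := fun ψ φ => by
        ext n
        simp [mul_add]
        rfl
      map_smul' := fun c ψ => by
        ext n
        simp [mul_left_comm] }
    (by
      obtain ⟨M, hM⟩ := hw
      refine ⟨M, fun ψ => ?_⟩
      exact lp.norm_le_of_tsum_le (by norm_num)
        (mul_nonneg ((abs_nonneg _).trans (hM 0)) (norm_nonneg _))
        (summable_weightedShift hM k ψ).2)

/-- The Jacobi operator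
`(H ψ) n = a n * ψ (n + 1) + a (n - 1) * ψ (n - 1) + b n * ψ n` on `ℓ²(ℤ)`,
for bounded real sequences `a`, `b`. -/
def jacobiOperator (a b : ℤ → ℝ) (ha : ∃ M : ℝ, ∀ n, |a n| ≤ M) (hb : ∃ M : ℝ, ∀ n, |b n| ≤ M) :
    EllTwo →L[ℂ] EllTwo :=
  weightedShift a ha 1
    + weightedShift (fun n => a (n - 1)) (ha.imp fun _ h n => h (n - 1)) (-1)
    + weightedShift b hb 0

theorem jacobiOperator_apply (a b : ℤ → ℝ) (ha : ∃ M : ℝ, ∀ n, |a n| ≤ M)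
    (hb : ∃ M : ℝ, ∀ n, |b n| ≤ M) (ψ : EllTwo) (n : ℤ) :
    jacobiOperator a b ha hb ψ n =
      (a n : ℂ) * ψ (n + 1) + (a (n - 1) : ℂ) * ψ (n - 1) + (b n : ℂ) * ψ n := by
  have h : ((b n : ℂ) * ψ (n + 0)) = (b n : ℂ) * ψ n := by rw [add_zero]
  rw [← h]
  rfl

/-- The Sturmian potential `b n = lam * (⌊(n + 1) β⌋ - ⌊n β⌋)`. -/
def sturmianPotential (lam β : ℝ) (n : ℤ) : ℝ :=
  lam * ((⌊((n : ℝ) + 1) * β⌋ : ℝ) - (⌊(n : ℝ) * β⌋ : ℝ))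

theorem sturmianPotential_bounded (lam β : ℝ) :
    ∃ M : ℝ, ∀ n, |sturmianPotential lam β n| ≤ M := by
  refine ⟨|lam| * (|β| + 1), fun n => ?_⟩
  rw [sturmianPotential, abs_mul]
  refine mul_le_mul_of_nonneg_left ?_ (abs_nonneg _)
  have h1 := Int.floor_le (((n : ℝ) + 1) * β)
  have h2 := Int.lt_floor_add_one (((n : ℝ) + 1) * β)
  have h3 := Int.floor_le ((n : ℝ) * β)
  have h4 := Int.lt_floor_add_one ((n : ℝ) * β)
  have h5 := le_abs_self β
  have h6 := neg_abs_le β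
  rw [abs_le]
  constructor <;> nlinarith

/-- The on-diagonal Sturmian operator:
`(H ψ) n = ψ (n + 1) + ψ (n - 1) + lam * (⌊(n + 1) β⌋ - ⌊n β⌋) * ψ n` on `ℓ²(ℤ)`. -/
def sturmianOperator (lam β : ℝ) : EllTwo →L[ℂ] EllTwo :=
  jacobiOperator (fun _ => 1) (sturmianPotential lam β) ⟨1, fun _ => by simp⟩
    (sturmianPotential_bounded lam β)

/-- The partial quotient `a_j`, `j ≥ 1`, of the continued fraction expansion
`β = ⌊β⌋ + 1 / (a_1 + 1 / (a_2 + ⋯))` of an irrational number `β`. -/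
def partialQuotient (β : ℝ) (j : ℕ) : ℝ :=
  ((GenContFract.of β).partDens.get? (j - 1)).getD 0

/-- `C_k = (3 / k) ∑_{j = 1}^k log (a_j + 2)`. -/
def logMean (β : ℝ) (k : ℕ) : ℝ :=
  3 / (k : ℝ) * ∑ j ∈ Finset.Icc 1 k, Real.log (partialQuotient β j + 2)

/-- The upper box-counting dimension `limsup_{ε → 0⁺} log N(ε) / (-log ε)`, where `N(ε)` is the
least number of closed balls of radius `ε / 2` (diameter at most `ε`), with arbitrary centres in
the ambient space, that cover `S`. -/
def upperBoxDim {X : Type*} [PseudoEMetricSpace X] (S : Set X) : EReal :=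
  limsup (fun ε : ℝ≥0 =>
    ENNReal.log ((Metric.externalCoveringNumber (ε / 2) S : ℕ∞) : ℝ≥0∞)
      / ((-Real.log (ε : ℝ) : ℝ) : EReal)) (𝓝[>] 0)

end

/-! Let `M k` be the transfer matrix over the denominator `q_k` of the `k`-th convergent. Then `M (k
+ 1) = M (k - 1) * M k ^ a k`, so all the traces come from one Chebyshev recursion, and the traces
of `M k`, `M (k - 1)` and `M (k - 1) * M k` satisfy the Fricke relation `f² + g² + h² - f g h = 4 +
lam²`. Where two of these traces are at most 2 in absolute value, `2 h - f g` has constant sign and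
modulus at least `2 lam`. So the third trace is large, and its derivative is controlled by the other
two through implicit differentiation.

A band is an interval on which one trace runs between 2 and -2 while a neighbouring trace stays in
`[-2, 2]`. There are three types. Inside a band of type II or III the next traces oscillate like
Chebyshev polynomials, which yields disjoint bands one level down (`BandPair.exists_chebRec`); a
band of type I contains one band of type II (`exists_typeII_of_typeI`). In each step counted, the
derivative bound grows by at most `(a k + 2)³ (lam + 5)`, so a band `m` levels down has length at
least 4 over the product of these factors, up to a constant. The number of such bands is at least `φ
^ m`, `φ` being the golden ratio (`goldenRatio_pow_le_descCount`).

Each band meets the spectrum. Following children indefinitely gives an energy at which, of any two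
consecutive `M k`, one has trace in `[-2, 2]`. Near-periodicity of the potential at the `q_k` and
Gordon's two-block argument put this energy in the spectrum (`mem_spectrum_of_bounded_traces`). A
ball of diameter at most the band length meets at most two of the disjoint bands, so `N(ε_m) ≥ φ ^ m
/ 2` with `-log ε_m ≤ (m + 1)(C + η + log (lam + 5)) + O(1)` for every `η > 0` and large `m`;
dividing logarithms gives the bound. -/

/-! ### The Chebyshev recursion. -/

/-- The solution of `t (n + 2) = x * t (n + 1) - t n` with `t 0 = s` and `t 1 = r`. -/
def chebRec (x s r : ℝ) : ℕ → ℝ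
  | 0 => s
  | 1 => r
  | n + 2 => x * chebRec x s r (n + 1) - chebRec x s r n

theorem chebRec_succ (x s r : ℝ) : ∀ n, chebRec x s r (n + 1) = chebRec x r (x * r - s) n
  | 0 => rfl
  | 1 => rfl
  | n + 2 => by
    rw [chebRec, chebRec_succ x s r (n + 1), chebRec_succ x s r n, chebRec]

/-- Vieta: terms `n` and `n + 2` are the two roots of the quadratic obtained by fixing `x` and term
`n + 1`. -/
theorem chebRec_fricke (x s r : ℝ) (n : ℕ) :
    x ^ 2 + chebRec x s r n ^ 2 + chebRec x s r (n + 1) ^ 2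
      - x * chebRec x s r n * chebRec x s r (n + 1) = x ^ 2 + s ^ 2 + r ^ 2 - x * s * r := by
  induction n with
  | zero => simp [chebRec]
  | succ n ih => rw [← ih, chebRec]; ring

/-- The rescaled Chebyshev polynomials of the second kind, shifted so that the value at index
`n` is `sin (n θ) / sin θ` at `x = 2 cos θ`. -/
def chebU (x : ℝ) (n : ℕ) : ℝ := chebRec x 0 1 n

theorem chebU_zero (x : ℝ) : chebU x 0 = 0 := rfl

theorem chebU_one (x : ℝ) : chebU x 1 = 1 := rfl

theorem chebU_add_two (x : ℝ) (n : ℕ) : chebU x (n + 2) = x * chebU x (n + 1) - chebU x n := rfl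

theorem chebRec_eq_chebU (x s r : ℝ) :
    ∀ n, chebRec x s r (n + 1) = r * chebU x (n + 1) - s * chebU x n
  | 0 => by simp [chebRec, chebU]
  | 1 => by simp [chebRec, chebU]; ring
  | n + 2 => by
    rw [chebRec, chebRec_eq_chebU x s r (n + 1), chebRec_eq_chebU x s r n, chebU_add_two x (n + 1),
      chebU_add_two x n]
    ring

theorem abs_chebU_le {x : ℝ} (hx : |x| ≤ 2) (n : ℕ) : |chebU x n| ≤ n := by
  induction n with
  | zero => simp [chebU_zero]
  | succ n ih =>
    have h1 : chebU x n ^ 2 + chebU x (n + 1) ^ 2 - x * chebU x n * chebU x (n + 1) = 1 := by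
      have := chebRec_fricke x 0 1 n
      simp only [chebU]; nlinarith
    have hx2 : x ^ 2 ≤ 4 := by nlinarith [sq_abs x, abs_nonneg x]
    -- Completing the square in the invariant: the left side squared is `1 - (1 - x² / 4) U_n²`.
    have h2 : |chebU x (n + 1) - x / 2 * chebU x n| ≤ 1 := by
      rw [← sq_le_one_iff_abs_le_one]
      nlinarith [mul_nonneg (sub_nonneg.2 hx2) (sq_nonneg (chebU x n))]
    have h3 : |x / 2 * chebU x n| ≤ n := by
      rw [abs_mul, abs_div, abs_two]
      nlinarith [abs_nonneg x, abs_nonneg (chebU x n)]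
    rw [abs_le] at *
    push_cast
    constructor <;> linarith [h2.1, h2.2, h3.1, h3.2]

/-- Duhamel's formula: the derivative solves the same recursion with source `chebU x (n + 1)`, hence
is a convolution of `chebU` with itself. -/
theorem hasDerivAt_chebU (x : ℝ) : ∀ n, HasDerivAt (fun y => chebU y n)
    (∑ i ∈ Finset.range n, chebU x i * chebU x (n - i)) x
  | 0 => by simpa [chebU_zero] using hasDerivAt_const x (0 : ℝ)
  | 1 => by simpa [chebU_zero, chebU_one] using hasDerivAt_const x (1 : ℝ)
  | n + 2 => by
    have h := ((hasDerivAt_id x).mul (hasDerivAt_chebU x (n + 1))).sub (hasDerivAt_chebU x n)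
    refine h.congr_deriv ?_
    have e : ∀ i ∈ Finset.range n, chebU x i * chebU x (n + 2 - i) =
        x * (chebU x i * chebU x (n + 1 - i)) - chebU x i * chebU x (n - i) := by
      intro i hi
      rw [Finset.mem_range] at hi
      obtain ⟨m, rfl⟩ := Nat.exists_eq_add_of_lt hi
      rw [show i + m + 1 + 2 - i = m + 1 + 2 by omega, show i + m + 1 + 1 - i = m + 1 + 1 by omega,
        show i + m + 1 - i = m + 1 by omega, chebU_add_two]
      ring
    rw [Finset.sum_range_succ, Finset.sum_range_succ, Finset.sum_range_succ (n := n),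
      Finset.sum_congr rfl e, Finset.sum_sub_distrib, ← Finset.mul_sum,
      show n + 2 - n = 2 by omega, show n + 2 - (n + 1) = 1 by omega,
      show n + 1 - n = 1 by omega, chebU_one, show chebU x 2 = x by simp [chebU, chebRec]]
    simp only [id]
    ring

theorem differentiable_chebU (n : ℕ) : Differentiable ℝ fun x => chebU x n :=
  fun x => (hasDerivAt_chebU x n).differentiableAt

theorem abs_deriv_chebU_le {x : ℝ} (hx : |x| ≤ 2) (n : ℕ) :
    |deriv (fun y => chebU y n) x| ≤ (n : ℝ) ^ 3 / 4 := by
  rw [(hasDerivAt_chebU x n).deriv]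
  refine (Finset.abs_sum_le_sum_abs _ _).trans ?_
  have : ∀ i ∈ Finset.range n, |chebU x i * chebU x (n - i)| ≤ (n : ℝ) ^ 2 / 4 := by
    intro i hi
    have hi' := (Finset.mem_range.1 hi).le
    rw [abs_mul]
    calc _ ≤ (i : ℝ) * ((n - i : ℕ) : ℝ) :=
          mul_le_mul (abs_chebU_le hx _) (abs_chebU_le hx _) (abs_nonneg _) (by positivity)
      _ ≤ _ := by
          rw [Nat.cast_sub hi']
          nlinarith [sq_nonneg ((n : ℝ) - 2 * i)]
  refine (Finset.sum_le_sum this).trans ?_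
  simp only [Finset.sum_const, Finset.card_range, nsmul_eq_mul]
  nlinarith

theorem chebRec_two_cos_mul_sin (θ s r : ℝ) : ∀ n : ℕ, chebRec (2 * Real.cos θ) s r n * Real.sin θ =
    r * Real.sin (n * θ) - s * Real.sin (n * θ - θ)
  | 0 => by simp [chebRec]
  | 1 => by simp [chebRec]
  | n + 2 => by
    have h1 := chebRec_two_cos_mul_sin θ s r (n + 1)
    have h2 := chebRec_two_cos_mul_sin θ s r n
    rw [chebRec, sub_mul, mul_assoc, h1, h2]
    have e (y : ℝ) : Real.sin (y + θ) = 2 * Real.cos θ * Real.sin y - Real.sin (y - θ) := by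
      rw [Real.sin_add, Real.sin_sub]; ring
    have e1 := e (n * θ + θ)
    have e2 := e (n * θ)
    rw [show ((n + 2 : ℕ) : ℝ) * θ = n * θ + θ + θ by push_cast; ring,
      show ((n + 1 : ℕ) : ℝ) * θ = n * θ + θ by push_cast; ring, e1]
    simp only [add_sub_cancel_right]
    rw [e2]
    ring

/-! ### The Fricke relation at a single energy. -/

section Fricke

variable {lam f g h : ℝ}

/-- The discriminant of the Fricke relation read as a quadratic in `h`. -/
theorem sq_two_mul_sub_of_fricke (hF : f ^ 2 + g ^ 2 + h ^ 2 - f * g * h = 4 + lam ^ 2) :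
    (2 * h - f * g) ^ 2 = (4 - f ^ 2) * (4 - g ^ 2) + 4 * lam ^ 2 := by
  linear_combination 4 * hF

theorem le_abs_two_mul_sub_of_fricke (hF : f ^ 2 + g ^ 2 + h ^ 2 - f * g * h = 4 + lam ^ 2)
    (hf : |f| ≤ 2) (hg : |g| ≤ 2) : 2 * lam ≤ |2 * h - f * g| := by
  have hf2 : f ^ 2 ≤ 4 := by nlinarith [sq_abs f, abs_nonneg f]
  have hg2 : g ^ 2 ≤ 4 := by nlinarith [sq_abs g, abs_nonneg g]
  refine (le_abs_self _).trans (sq_le_sq.1 ?_)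
  rw [sq_two_mul_sub_of_fricke hF]
  nlinarith [mul_nonneg (sub_nonneg.2 hf2) (sub_nonneg.2 hg2)]

theorem abs_le_of_fricke (hlam : 20 < lam)
    (hF : f ^ 2 + g ^ 2 + h ^ 2 - f * g * h = 4 + lam ^ 2)
    (hf : |f| ≤ 2) (hg : |g| ≤ 2) : |h| ≤ lam + 5 / 2 := by
  have hf2 : f ^ 2 ≤ 4 := by nlinarith [sq_abs f, abs_nonneg f]
  have hg2 : g ^ 2 ≤ 4 := by nlinarith [sq_abs g, abs_nonneg g]
  have h1 : |2 * h - f * g| ≤ 2 * lam + 1 := by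
    refine abs_le_of_sq_le_sq ?_ (by linarith)
    rw [sq_two_mul_sub_of_fricke hF]
    nlinarith [sq_nonneg f, sq_nonneg g]
  have h2 : |f * g| ≤ 4 := by
    rw [abs_mul]; nlinarith [abs_nonneg f, abs_nonneg g]
  rw [abs_le] at *
  constructor <;> linarith [h1.1, h1.2, h2.1, h2.2]

/-- Implicit differentiation: the quotient is at most `2 (2 lam + 9) D / (2 lam)`, and `9 / lam < 1
/ 2` since `lam > 20`. -/
theorem abs_deriv_le_of_fricke {f' g' h' D : ℝ} (hlam : 20 < lam)
    (hF : f ^ 2 + g ^ 2 + h ^ 2 - f * g * h = 4 + lam ^ 2)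
    (hF' : (2 * h - f * g) * h' = -((2 * f - g * h) * f') - (2 * g - f * h) * g')
    (hf : |f| ≤ 2) (hg : |g| ≤ 2) (hf' : |f'| ≤ D) (hg' : |g'| ≤ D) : |h'| ≤ 5 / 2 * D := by
  have hD : 0 ≤ D := (abs_nonneg _).trans hf'
  have hh := abs_le_of_fricke hlam hF hf hg
  have h1 : |2 * f - g * h| ≤ 2 * lam + 9 := by
    refine (abs_sub _ _).trans ?_
    rw [abs_mul, abs_mul, abs_two]
    nlinarith [abs_nonneg g, abs_nonneg h]
  have h2 : |2 * g - f * h| ≤ 2 * lam + 9 := by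
    refine (abs_sub _ _).trans ?_
    rw [abs_mul, abs_mul, abs_two]
    nlinarith [abs_nonneg f, abs_nonneg h]
  have h3 : |2 * h - f * g| * |h'| ≤ (2 * lam + 9) * D + (2 * lam + 9) * D := by
    rw [← abs_mul, hF']
    refine (abs_sub _ _).trans ?_
    rw [abs_neg, abs_mul, abs_mul]
    gcongr
  have h4 := mul_le_mul_of_nonneg_right (le_abs_two_mul_sub_of_fricke hF hf hg) (abs_nonneg h')
  by_contra! hc
  nlinarith

end Fricke

/-! ### Crossing intervals from intermediate values. -/

/-- `f` maps `[u, v]` into `[-2, 2]` and takes the values `2` and `-2` at the end points. -/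
structure Crosses (f : ℝ → ℝ) (u v : ℝ) : Prop where
  lt : u < v
  abs_le : ∀ e ∈ Set.Icc u v, |f e| ≤ 2
  ends : (f u = 2 ∧ f v = -2) ∨ (f u = -2 ∧ f v = 2)

theorem Crosses.neg {f : ℝ → ℝ} {u v : ℝ} (h : Crosses f u v) : Crosses (fun e => -f e) u v where
  lt := h.lt
  abs_le e he := by simpa using h.abs_le e he
  ends := by rcases h.ends with h | h <;> simp [h.1, h.2]

theorem exists_crosses_aux {f : ℝ → ℝ} (hf : Continuous f) {u v : ℝ} (huv : u ≤ v)
    (hu : 2 < f u) (hv : f v < -2) : ∃ u' v', u < u' ∧ v' < v ∧ Crosses f u' v' := by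
  have hc : IsCompact (Set.Icc u v ∩ f ⁻¹' {-2}) :=
    isCompact_Icc.inter_right (isClosed_singleton.preimage hf)
  have hne : (Set.Icc u v ∩ f ⁻¹' {-2}).Nonempty := by
    obtain ⟨c, hc, h⟩ := intermediate_value_Icc' huv hf.continuousOn
      (show (-2 : ℝ) ∈ Set.Icc (f v) (f u) from ⟨by linarith, by linarith⟩)
    exact ⟨c, hc, h⟩
  -- `v'` is the first point with value -2, and `u'` below is the last point before it with value 2;
  -- in between, `f` cannot leave `[-2, 2]`.
  obtain ⟨v', ⟨hv'1, hv'2⟩, hv'3⟩ := hc.exists_isLeast hne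
  have hv'2 : f v' = -2 := hv'2
  have hc2 : IsCompact (Set.Icc u v' ∩ f ⁻¹' {2}) :=
    isCompact_Icc.inter_right (isClosed_singleton.preimage hf)
  have hne2 : (Set.Icc u v' ∩ f ⁻¹' {2}).Nonempty := by
    obtain ⟨c, hc, h⟩ := intermediate_value_Icc' hv'1.1 hf.continuousOn
      (show (2 : ℝ) ∈ Set.Icc (f v') (f u) from ⟨by linarith, by linarith⟩)
    exact ⟨c, hc, h⟩
  obtain ⟨u', ⟨hu'1, hu'2⟩, hu'3⟩ := hc2.exists_isGreatest hne2
  have hu'2 : f u' = 2 := hu'2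
  refine ⟨u', v', lt_of_le_of_ne hu'1.1 ?_, lt_of_le_of_ne hv'1.2 ?_,
    lt_of_le_of_ne hu'1.2 ?_, ?_, .inl ⟨hu'2, hv'2⟩⟩
  · rintro rfl; linarith
  · rintro rfl; linarith
  · rintro rfl; linarith
  · intro e he
    rw [abs_le]
    constructor
    · by_contra! hlt
      obtain ⟨c, hc, h⟩ := intermediate_value_Icc' he.1 hf.continuousOn
        (show (-2 : ℝ) ∈ Set.Icc (f e) (f u') from ⟨by linarith, by linarith⟩)
      have := hv'3 ⟨⟨hu'1.1.trans hc.1, (hc.2.trans he.2).trans hv'1.2⟩, h⟩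
      have : e = v' := le_antisymm he.2 (this.trans hc.2)
      subst this; linarith
    · by_contra! hlt
      obtain ⟨c, hc, h⟩ := intermediate_value_Icc' he.2 hf.continuousOn
        (show (2 : ℝ) ∈ Set.Icc (f v') (f e) from ⟨by linarith, by linarith⟩)
      have := hu'3 ⟨⟨(hu'1.1.trans he.1).trans hc.1, hc.2⟩, h⟩
      have : e = u' := le_antisymm (hc.1.trans this) he.1
      subst this; linarith

theorem exists_crosses {f : ℝ → ℝ} (hf : Continuous f) {u v : ℝ} (huv : u ≤ v)
    (hu : 2 < |f u|) (hv : 2 < |f v|) (h : f u * f v < 0) :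
    ∃ u' v', u < u' ∧ v' < v ∧ Crosses f u' v' := by
  rcases mul_neg_iff.1 h with ⟨h1, h2⟩ | ⟨h1, h2⟩
  · rw [abs_of_pos h1] at hu
    rw [abs_of_neg h2] at hv
    exact exists_crosses_aux hf huv hu (by linarith)
  · rw [abs_of_neg h1] at hu
    rw [abs_of_pos h2] at hv
    obtain ⟨u', v', h1, h2, h3⟩ := exists_crosses_aux hf.neg huv hu (by simpa using hv)
    exact ⟨u', v', h1, h2, by simpa using h3.neg⟩

/-- A continuous function attains a decreasing list of intermediate values at an increasing list
of points. -/
theorem exists_increasing_preimages {f : ℝ → ℝ} (hf : Continuous f) (c : ℕ → ℝ) (p : ℕ) :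
    ∀ {u v : ℝ}, u ≤ v → (∀ i j, i ≤ j → j ≤ p → c j ≤ c i) → c 0 ≤ f u → f v ≤ c p →
    ∃ e : ℕ → ℝ, (∀ j ≤ p, e j ∈ Set.Icc u v ∧ f (e j) = c j) ∧
      ∀ i j, i ≤ j → j ≤ p → e i ≤ e j := by
  induction p with
  | zero =>
    intro u v huv _ h0 h1
    obtain ⟨e, he, h⟩ := intermediate_value_Icc' huv hf.continuousOn
      (show c 0 ∈ Set.Icc (f v) (f u) from ⟨h1, h0⟩)
    refine ⟨fun _ => e, fun j hj => ?_, fun _ _ _ _ => le_rfl⟩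
    rw [Nat.le_zero.1 hj]; exact ⟨he, h⟩
  | succ p ih =>
    intro u v huv hc h0 h1
    obtain ⟨w, hw, h⟩ := intermediate_value_Icc' huv hf.continuousOn
      (show c (p + 1) ∈ Set.Icc (f v) (f u) from
      ⟨h1, (hc 0 _ (Nat.zero_le _) le_rfl).trans h0⟩)
    obtain ⟨e, he1, he2⟩ := ih hw.1 (fun i j hij hj => hc i j hij (hj.trans (Nat.le_succ p))) h0
      (h.le.trans (hc p _ (Nat.le_succ p) le_rfl))
    refine ⟨fun j => if j ≤ p then e j else w, fun j hj => ?_, fun i j hij hj => ?_⟩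
    · by_cases hjp : j ≤ p
      · simp only [hjp, if_true]
        exact ⟨⟨(he1 j hjp).1.1, (he1 j hjp).1.2.trans hw.2⟩, (he1 j hjp).2⟩
      · obtain rfl : j = p + 1 := by omega
        simp only [hjp, if_false]
        exact ⟨hw, h⟩
    · by_cases hjp : j ≤ p
      · simp only [hjp, hij.trans hjp, if_true]
        exact he2 i j hij hjp
      · simp only [hjp, if_false]
        split_ifs with hi
        · exact (he1 i hi).1.2
        · exact le_rfl

/-! ### Band pairs and the bands inside them. -/

/-- An interval `[u, v]` on which `f` crosses `[-2, 2]`, `g` is bounded by `2`, and both have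
derivative bounded by `D`. -/
structure BandPair (f g : ℝ → ℝ) (u v D : ℝ) : Prop where
  crosses : Crosses f u v
  abs_snd_le : ∀ e ∈ Set.Icc u v, |g e| ≤ 2
  abs_deriv_fst_le : ∀ e ∈ Set.Icc u v, |deriv f e| ≤ D
  abs_deriv_snd_le : ∀ e ∈ Set.Icc u v, |deriv g e| ≤ D

theorem BandPair.mono {f g : ℝ → ℝ} {u v D D' : ℝ} (b : BandPair f g u v D) (h : D ≤ D') :
    BandPair f g u v D' :=
  ⟨b.crosses, b.abs_snd_le, fun e he => (b.abs_deriv_fst_le e he).trans h,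
    fun e he => (b.abs_deriv_snd_le e he).trans h⟩

theorem BandPair.nonneg {f g : ℝ → ℝ} {u v D : ℝ} (b : BandPair f g u v D) : 0 ≤ D :=
  (abs_nonneg _).trans (b.abs_deriv_fst_le u ⟨le_rfl, b.crosses.lt.le⟩)

/-- Mean value inequality: this turns derivative bounds into lower bounds on band lengths. -/
theorem BandPair.four_le {f g : ℝ → ℝ} {u v D : ℝ} (hf : Differentiable ℝ f)
    (b : BandPair f g u v D) : 4 ≤ D * (v - u) := by
  have h := (convex_Icc u v).norm_image_sub_le_of_norm_deriv_le (f := f) (C := D)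
    (fun x _ => hf x) (fun x hx => b.abs_deriv_fst_le x hx)
    ⟨le_rfl, b.crosses.lt.le⟩ ⟨b.crosses.lt.le, le_rfl⟩
  rw [Real.norm_eq_abs, Real.norm_eq_abs, abs_of_pos (sub_pos.2 b.crosses.lt)] at h
  rcases b.crosses.ends with ⟨h1, h2⟩ | ⟨h1, h2⟩ <;> rw [h1, h2] at h <;> norm_num at h <;> exact h

/-- Three functions subject to the Fricke relation, as satisfied by the traces of `A`, `B` and
`B * A` for unimodular matrices `A`, `B` with commutator of trace `2 + lam ^ 2`. -/
structure FrickeTriple (lam : ℝ) (f g h : ℝ → ℝ) : Prop where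
  diff_fst : Differentiable ℝ f
  diff_snd : Differentiable ℝ g
  diff_trd : Differentiable ℝ h
  fricke : ∀ e, f e ^ 2 + g e ^ 2 + h e ^ 2 - f e * g e * h e = 4 + lam ^ 2

section

variable {lam : ℝ} {f g h : ℝ → ℝ} {u v D : ℝ}

theorem FrickeTriple.continuous_discr (T : FrickeTriple lam f g h) :
    Continuous fun e => 2 * h e - f e * g e :=
  (T.diff_trd.continuous.const_mul 2).sub (T.diff_fst.continuous.mul T.diff_snd.continuous)

/-- The discriminant root `2 h - f g` is continuous and cannot vanish on the interval, so its sign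
is constant. -/
theorem FrickeTriple.discr_mul_pos (T : FrickeTriple lam f g h) (hlam : 20 < lam)
    (hf : ∀ e ∈ Set.Icc u v, |f e| ≤ 2) (hg : ∀ e ∈ Set.Icc u v, |g e| ≤ 2) {e e' : ℝ}
    (he : e ∈ Set.Icc u v) (he' : e' ∈ Set.Icc u v) :
    0 < (2 * h e - f e * g e) * (2 * h e' - f e' * g e') := by
  have key : ∀ y ∈ Set.Icc u v, 2 * h y - f y * g y ≠ 0 := by
    intro y hy h0
    have := le_abs_two_mul_sub_of_fricke (T.fricke y) (hf y hy) (hg y hy)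
    rw [h0, abs_zero] at this
    linarith
  by_contra! hn
  have hm : (0 : ℝ) ∈ Set.uIcc (2 * h e - f e * g e) (2 * h e' - f e' * g e') := by
    rw [Set.mem_uIcc]
    rcases mul_nonpos_iff.1 hn with ⟨h1, h2⟩ | ⟨h1, h2⟩
    · exact .inr ⟨h2, h1⟩
    · exact .inl ⟨h1, h2⟩
  obtain ⟨c, hc, hc0⟩ := intermediate_value_uIcc T.continuous_discr.continuousOn hm
  exact key c (Set.uIcc_subset_Icc he he' hc) hc0

theorem FrickeTriple.abs_trd_le (T : FrickeTriple lam f g h) (hlam : 20 < lam)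
    (b : BandPair f g u v D) {e : ℝ} (he : e ∈ Set.Icc u v) : |h e| ≤ lam + 5 / 2 :=
  abs_le_of_fricke hlam (T.fricke e) (b.crosses.abs_le e he) (b.abs_snd_le e he)

theorem FrickeTriple.abs_deriv_trd_le (T : FrickeTriple lam f g h) (hlam : 20 < lam)
    (b : BandPair f g u v D) {e : ℝ} (he : e ∈ Set.Icc u v) : |deriv h e| ≤ 5 / 2 * D := by
  refine abs_deriv_le_of_fricke hlam (T.fricke e) ?_ (b.crosses.abs_le e he) (b.abs_snd_le e he)
    (b.abs_deriv_fst_le e he) (b.abs_deriv_snd_le e he)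
  have h1 := (((T.diff_fst e).hasDerivAt.pow 2).add ((T.diff_snd e).hasDerivAt.pow 2)).add
    ((T.diff_trd e).hasDerivAt.pow 2) |>.sub
    (((T.diff_fst e).hasDerivAt.mul (T.diff_snd e).hasDerivAt).mul (T.diff_trd e).hasDerivAt)
  have h2 := h1.unique ((hasDerivAt_const e (4 + lam ^ 2)).congr_of_eventuallyEq
    (Eventually.of_forall T.fricke))
  simp only [Pi.mul_apply] at h2
  push_cast at h2
  linear_combination h2

theorem FrickeTriple.next (T : FrickeTriple lam f g h) :
    FrickeTriple lam (fun e => h e * f e - g e) f h where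
  diff_fst := (T.diff_trd.mul T.diff_fst).sub T.diff_snd
  diff_snd := T.diff_fst
  diff_trd := T.diff_trd
  fricke e := by rw [← T.fricke e]; ring

/-- If `f` crosses and `g` is bounded, so that `h` is large, then `h * f - g` crosses inside. -/
theorem BandPair.exists_next (T : FrickeTriple lam f g h) (hlam : 20 < lam)
    (b : BandPair f g u v D) : ∃ u' v', u ≤ u' ∧ v' ≤ v ∧
      BandPair (fun e => h e * f e - g e) f u' v' ((lam + 9) * D) := by
  have hu : u ∈ Set.Icc u v := ⟨le_rfl, b.crosses.lt.le⟩
  have hv : v ∈ Set.Icc u v := ⟨b.crosses.lt.le, le_rfl⟩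
  have hpos := T.discr_mul_pos hlam b.crosses.abs_le b.abs_snd_le hu hv
  have hGu := le_abs_two_mul_sub_of_fricke (T.fricke u) (b.crosses.abs_le u hu) (b.abs_snd_le u hu)
  have hGv := le_abs_two_mul_sub_of_fricke (T.fricke v) (b.crosses.abs_le v hv) (b.abs_snd_le v hv)
  have hgu := abs_le.1 (b.abs_snd_le u hu)
  have hgv := abs_le.1 (b.abs_snd_le v hv)
  -- Where `f = 2 s` with `s = ±1`, one has `h f - g = s (2 h - f g) + g`: the first term has
  -- modulus at least `2 lam`, and its sign flips with `s` between the end points.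
  have key : 2 < |h u * f u - g u| ∧ 2 < |h v * f v - g v| ∧
      (h u * f u - g u) * (h v * f v - g v) < 0 := by
    rcases b.crosses.ends with ⟨h1, h2⟩ | ⟨h1, h2⟩ <;> rw [h1] at hpos hGu ⊢ <;>
      rw [h2] at hpos hGv ⊢ <;>
    rcases mul_pos_iff.1 hpos with ⟨h3, h4⟩ | ⟨h3, h4⟩ <;>
    first
      | rw [abs_of_pos h3] at hGu
        rw [abs_of_pos h4] at hGv
      | rw [abs_of_neg h3] at hGu
        rw [abs_of_neg h4] at hGv
    all_goals
      refine ⟨lt_abs.2 ?_, lt_abs.2 ?_, ?_⟩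
      · first
          | exact .inl (by linarith [hgu.1, hgu.2])
          | exact .inr (by linarith [hgu.1, hgu.2])
      · first
          | exact .inl (by linarith [hgv.1, hgv.2])
          | exact .inr (by linarith [hgv.1, hgv.2])
      · first
          | exact mul_neg_of_pos_of_neg (by linarith [hgu.1, hgu.2]) (by linarith [hgv.1, hgv.2])
          | exact mul_neg_of_neg_of_pos (by linarith [hgu.1, hgu.2]) (by linarith [hgv.1, hgv.2])
  obtain ⟨u', v', h1, h2, hcr⟩ := exists_crosses T.next.diff_fst.continuous b.crosses.lt.le
    key.1 key.2.1 key.2.2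
  have hsub : ∀ e ∈ Set.Icc u' v', e ∈ Set.Icc u v :=
    fun e he => ⟨h1.le.trans he.1, he.2.trans h2.le⟩
  have hD := b.nonneg
  refine ⟨u', v', h1.le, h2.le, hcr, fun e he => b.crosses.abs_le e (hsub e he), fun e he => ?_,
    fun e he => (b.abs_deriv_fst_le e (hsub e he)).trans (by nlinarith)⟩
  have he' := hsub e he
  have hd : deriv (fun e => h e * f e - g e) e = deriv h e * f e + h e * deriv f e - deriv g e :=
    (((T.diff_trd e).hasDerivAt.mul (T.diff_fst e).hasDerivAt).sub
      (T.diff_snd e).hasDerivAt).deriv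
  rw [hd]
  have a1 : |deriv h e * f e| ≤ 5 / 2 * D * 2 := by
    rw [abs_mul]
    exact mul_le_mul (T.abs_deriv_trd_le hlam b he') (b.crosses.abs_le e he') (abs_nonneg _)
      (by positivity)
  have a2 : |h e * deriv f e| ≤ (lam + 5 / 2) * D := by
    rw [abs_mul]
    exact mul_le_mul (T.abs_trd_le hlam b he') (b.abs_deriv_fst_le e he') (abs_nonneg _)
      (by positivity)
  have a3 := b.abs_deriv_snd_le e he'
  calc _ ≤ |deriv h e * f e| + |h e * deriv f e| + |deriv g e| :=
        (abs_sub _ _).trans (by gcongr; exact abs_add_le _ _)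
    _ ≤ _ := by nlinarith

/-- The nodes are the `p + 1` zeros of the Chebyshev polynomial of the first kind of degree `p + 1`,
rescaled to `[-2, 2]`. They are listed along the interval, so in reverse when `f` increases from -2
to 2; either way the parity of `ι` alternates. -/
theorem exists_nodes (b : Crosses f u v) (hf : Continuous f) (p : ℕ) :
    ∃ (e : ℕ → ℝ) (ι : ℕ → ℕ), (∀ j ≤ p, e j ∈ Set.Icc u v ∧ ι j ≤ p ∧
      f (e j) = 2 * Real.cos ((ι j + 1 / 2) * (Real.pi / (p + 1)))) ∧
      (∀ i j, i ≤ j → j ≤ p → e i ≤ e j) ∧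
      ∀ j, j + 1 ≤ p → (-1 : ℝ) ^ ι j * (-1) ^ ι (j + 1) = -1 := by
  set c : ℕ → ℝ := fun j => 2 * Real.cos ((j + 1 / 2) * (Real.pi / (p + 1))) with hc
  have hp : (0 : ℝ) < p + 1 := by positivity
  have hpi := Real.pi_pos
  have hle : ∀ j : ℕ, j ≤ p → (j + 1 / 2) * (Real.pi / (p + 1)) ≤ Real.pi := by
    intro j hj
    have : (j : ℝ) ≤ p := by exact_mod_cast hj
    rw [← mul_div_assoc, div_le_iff₀ hp]
    nlinarith
  have hanti : ∀ i j, i ≤ j → j ≤ p → c j ≤ c i := by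
    intro i j hij hj
    refine mul_le_mul_of_nonneg_left (Real.cos_le_cos_of_nonneg_of_le_pi (by positivity)
      (hle j hj) ?_) two_pos.le
    have : (i : ℝ) ≤ j := by exact_mod_cast hij
    gcongr
  have hc2 : ∀ j, c j ≤ 2 ∧ -2 ≤ c j := fun j =>
    ⟨by linarith [Real.cos_le_one ((j + 1 / 2) * (Real.pi / (p + 1)))],
      by linarith [Real.neg_one_le_cos ((j + 1 / 2) * (Real.pi / (p + 1)))]⟩
  rcases b.ends with ⟨h1, h2⟩ | ⟨h1, h2⟩
  · obtain ⟨e, he, hm⟩ := exists_increasing_preimages hf c p b.lt.le hanti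
      (by rw [h1]; exact (hc2 0).1) (by rw [h2]; exact (hc2 p).2)
    refine ⟨e, id, fun j hj => ⟨(he j hj).1, hj, (he j hj).2⟩, hm, fun j _ => ?_⟩
    simp only [id]
    rw [pow_succ, ← mul_assoc, ← mul_pow]; norm_num
  · obtain ⟨e, he, hm⟩ := exists_increasing_preimages (f := fun y => -f y) hf.neg c p b.lt.le hanti
      (by simpa [h1] using (hc2 0).1) (by simpa [h2] using (hc2 p).2)
    refine ⟨e, fun j => p - j, fun j hj => ⟨(he j hj).1, Nat.sub_le _ _, ?_⟩, hm, fun j hj => ?_⟩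
    · have h3 : f (e j) = -c j := by rw [← (he j hj).2, neg_neg]
      simp only
      rw [h3, hc, ← mul_neg, ← Real.cos_pi_sub]
      congr 2
      rw [Nat.cast_sub hj]
      field_simp
      ring
    · obtain ⟨m, rfl⟩ := Nat.exists_eq_add_of_le hj
      simp only
      rw [show j + 1 + m - j = m + 1 by omega, show j + 1 + m - (j + 1) = m by omega,
        pow_succ, mul_right_comm, ← mul_pow]
      norm_num

/-- At a node `cos ((p + 1) θ) = 0` and `sin ((p + 1) θ) = (-1) ^ i`. The value is thus the
discriminant root times an alternating sign, with weight `1 / (2 sin θ)`. -/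
theorem chebRec_at_node (p i : ℕ) (hi : i ≤ p) (s r : ℝ) {x : ℝ}
    (hx : x = 2 * Real.cos ((i + 1 / 2) * (Real.pi / (p + 1)))) :
    ∃ w : ℝ, 1 / 2 ≤ w ∧ chebRec x s r (p + 1) = (-1) ^ i * (2 * r - x * s) * w := by
  have hp : (0 : ℝ) < p + 1 := by positivity
  have hpi := Real.pi_pos
  set θ := ((i : ℝ) + 1 / 2) * (Real.pi / (p + 1)) with hθ
  have hsin : 0 < Real.sin θ := by
    apply Real.sin_pos_of_pos_of_lt_pi (by positivity)
    have : (i : ℝ) ≤ p := by exact_mod_cast hi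
    rw [hθ, ← mul_div_assoc, div_lt_iff₀ hp]
    nlinarith
  have h := chebRec_two_cos_mul_sin θ s r (p + 1)
  have e : ((p + 1 : ℕ) : ℝ) * θ = i * Real.pi + Real.pi / 2 := by
    rw [hθ]; push_cast; field_simp
  rw [Real.sin_sub, e, Real.sin_add_pi_div_two, Real.cos_add_pi_div_two, Real.sin_nat_mul_pi,
    Real.cos_nat_mul_pi, ← hx] at h
  refine ⟨1 / (2 * Real.sin θ), ?_, ?_⟩
  · rw [div_le_div_iff₀ two_pos (by positivity)]
    linarith [Real.sin_le_one θ]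
  · rw [mul_one_div, eq_div_iff (by positivity)]
    rw [hx] at h ⊢
    linear_combination 2 * h

theorem hasDerivAt_chebRec (T : FrickeTriple lam f g h) (p : ℕ) (e : ℝ) :
    HasDerivAt (fun e => chebRec (f e) (g e) (h e) (p + 1))
      (deriv h e * chebU (f e) (p + 1) +
        h e * (deriv (fun y => chebU y (p + 1)) (f e) * deriv f e)
        - (deriv g e * chebU (f e) p
          + g e * (deriv (fun y => chebU y p) (f e) * deriv f e))) e := by
  simp only [chebRec_eq_chebU]
  have hU : ∀ n, HasDerivAt (fun y => chebU (f y) n)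
      (deriv (fun y => chebU y n) (f e) * deriv f e) e := fun n =>
    HasDerivAt.comp (h₂ := fun y => chebU y n) e
      (differentiable_chebU n (f e)).hasDerivAt (T.diff_fst e).hasDerivAt
  exact ((T.diff_trd e).hasDerivAt.mul (hU (p + 1))).sub ((T.diff_snd e).hasDerivAt.mul (hU p))

theorem abs_deriv_chebRec_le (T : FrickeTriple lam f g h) (hlam : 20 < lam)
    (b : BandPair f g u v D) (p : ℕ) {e : ℝ} (he : e ∈ Set.Icc u v) :
    |deriv (fun e => chebRec (f e) (g e) (h e) (p + 1)) e| ≤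
      ((p : ℝ) + 1) ^ 3 * (lam + 5) * D := by
  rw [(hasDerivAt_chebRec T p e).deriv]
  have hD := b.nonneg
  have hf := b.crosses.abs_le e he
  have a1 : |deriv h e * chebU (f e) (p + 1)| ≤ 5 / 2 * D * (p + 1) := by
    rw [abs_mul]
    exact mul_le_mul (T.abs_deriv_trd_le hlam b he) (by simpa using abs_chebU_le hf (p + 1))
      (abs_nonneg _) (by positivity)
  have a2 : |h e * (deriv (fun y => chebU y (p + 1)) (f e) * deriv f e)| ≤
      (lam + 5 / 2) * (((p : ℝ) + 1) ^ 3 / 4 * D) := by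
    rw [abs_mul, abs_mul]
    gcongr
    · exact T.abs_trd_le hlam b he
    · simpa using abs_deriv_chebU_le hf (p + 1)
    · exact b.abs_deriv_fst_le e he
  have a3 : |deriv g e * chebU (f e) p| ≤ D * (p + 1) := by
    rw [abs_mul]
    refine mul_le_mul (b.abs_deriv_snd_le e he) ((abs_chebU_le hf p).trans (by simp))
      (abs_nonneg _) (by positivity)
  have a4 : |g e * (deriv (fun y => chebU y p) (f e) * deriv f e)| ≤
      2 * (((p : ℝ) + 1) ^ 3 / 4 * D) := by
    rw [abs_mul, abs_mul]
    gcongr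
    · exact b.abs_snd_le e he
    · refine (abs_deriv_chebU_le hf p).trans ?_
      gcongr
      simp
    · exact b.abs_deriv_fst_le e he
  have hp : ((p : ℝ) + 1) * D ≤ ((p : ℝ) + 1) ^ 3 * D :=
    mul_le_mul_of_nonneg_right (le_self_pow₀ (by simp) (by norm_num)) hD
  have hp' : 0 ≤ ((p : ℝ) + 1) ^ 3 * D := by positivity
  calc _ ≤ _ := (abs_sub _ _).trans (add_le_add ((abs_add_le _ _).trans (add_le_add a1 a2))
        ((abs_add_le _ _).trans (add_le_add a3 a4)))
    _ ≤ _ := by nlinarith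

/-- Where `f` crosses and `g` is bounded, the Chebyshev recursion of index `p + 1` crosses on `p`
disjoint intervals. -/
theorem BandPair.exists_chebRec (T : FrickeTriple lam f g h) (hlam : 20 < lam)
    (b : BandPair f g u v D) (p : ℕ) : ∃ F : Finset (ℝ × ℝ), F.card = p ∧
      (F : Set (ℝ × ℝ)).PairwiseDisjoint (fun I => Set.Icc I.1 I.2) ∧
      ∀ I ∈ F, u ≤ I.1 ∧ I.2 ≤ v ∧ BandPair (fun e => chebRec (f e) (g e) (h e) (p + 1)) f I.1 I.2
        (((p : ℝ) + 1) ^ 3 * (lam + 5) * D) := by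
  obtain ⟨e, ι, he, hmono, hsign⟩ := exists_nodes b.crosses T.diff_fst.continuous p
  have hcont : Continuous (fun e => chebRec (f e) (g e) (h e) (p + 1)) :=
    continuous_iff_continuousAt.2 fun e => (hasDerivAt_chebRec T p e).continuousAt
  -- At consecutive nodes the recursion has opposite signs and modulus at least `lam > 2`, so it
  -- crosses in between: `p + 1` nodes give `p` crossings.
  have hex : ∀ j : Fin p, ∃ I : ℝ × ℝ, e j < I.1 ∧ I.2 < e (j + 1) ∧
      Crosses (fun e => chebRec (f e) (g e) (h e) (p + 1)) I.1 I.2 := by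
    intro j
    have hj1 : (j : ℕ) + 1 ≤ p := j.2
    have hj0 : (j : ℕ) ≤ p := j.2.le
    obtain ⟨m1, i1, x1⟩ := he j hj0
    obtain ⟨m2, i2, x2⟩ := he (j + 1) hj1
    obtain ⟨w1, hw1, y1⟩ := chebRec_at_node p _ i1 (g (e j)) (h (e j)) x1
    obtain ⟨w2, hw2, y2⟩ := chebRec_at_node p _ i2 (g (e (j + 1))) (h (e (j + 1))) x2
    have hpos := T.discr_mul_pos hlam b.crosses.abs_le b.abs_snd_le m1 m2
    have hG1 := le_abs_two_mul_sub_of_fricke (T.fricke _) (b.crosses.abs_le _ m1)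
      (b.abs_snd_le _ m1)
    have hG2 := le_abs_two_mul_sub_of_fricke (T.fricke _) (b.crosses.abs_le _ m2)
      (b.abs_snd_le _ m2)
    obtain ⟨u', v', h1, h2, h3⟩ := exists_crosses hcont (hmono j (j + 1) (Nat.le_succ _) hj1)
      (by
        rw [y1, abs_mul, abs_mul, abs_pow, abs_neg, abs_one, one_pow, one_mul,
          abs_of_pos (a := w1) (by linarith)]
        nlinarith)
      (by
        rw [y2, abs_mul, abs_mul, abs_pow, abs_neg, abs_one, one_pow, one_mul,
          abs_of_pos (a := w2) (by linarith)]
        nlinarith)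
      (by
        rw [y1, y2, show ∀ a b c a' b' c' : ℝ, a * b * c * (a' * b' * c') =
          (a * a') * ((b * b') * (c * c')) from fun _ _ _ _ _ _ => by ring, hsign j hj1]
        have := mul_pos hpos (mul_pos (show 0 < w1 by linarith) (show 0 < w2 by linarith))
        linarith)
    exact ⟨(u', v'), h1, h2, h3⟩
  choose I hI1 hI2 hI3 using hex
  have hlt : ∀ i j : Fin p, i < j → (I i).2 < (I j).1 := fun i j hij =>
    (hI2 i).trans_le ((hmono (i + 1) j hij j.2.le).trans (hI1 j).le)
  have hdisj : ∀ i j : Fin p, i ≠ j →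
      Disjoint (Set.Icc (I i).1 (I i).2) (Set.Icc (I j).1 (I j).2) := by
    intro i j hij
    rw [Set.disjoint_left]
    intro y hy hy'
    rcases lt_or_gt_of_ne hij with h | h
    · linarith [hlt i j h, hy.2, hy'.1]
    · linarith [hlt j i h, hy'.2, hy.1]
  have hinj : Function.Injective I := by
    intro i j hij
    by_contra hne
    have := hdisj i j hne
    rw [hij, disjoint_self] at this
    exact (Set.nonempty_Icc.2 (hI3 j).lt.le).ne_empty this
  refine ⟨Finset.univ.map ⟨I, hinj⟩, by simp, ?_, ?_⟩
  · intro A hA B hB hAB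
    simp only [Finset.coe_map, Finset.coe_univ, Set.image_univ, Function.Embedding.coeFn_mk,
      Set.mem_range] at hA hB
    obtain ⟨i, rfl⟩ := hA
    obtain ⟨j, rfl⟩ := hB
    exact hdisj i j fun h => hAB (by rw [h])
  · intro A hA
    simp only [Finset.mem_map, Finset.mem_univ, true_and, Function.Embedding.coeFn_mk] at hA
    obtain ⟨i, rfl⟩ := hA
    have hu : u ≤ (I i).1 := (he i i.2.le).1.1.trans (hI1 i).le
    have hv : (I i).2 ≤ v := (hI2 i).le.trans (he (i + 1) i.2).1.2
    have hsub : ∀ e ∈ Set.Icc (I i).1 (I i).2, e ∈ Set.Icc u v :=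
      fun e he => ⟨hu.trans he.1, he.2.trans hv⟩
    have hD := b.nonneg
    refine ⟨hu, hv, hI3 i, fun e he => b.crosses.abs_le e (hsub e he),
      fun e he => abs_deriv_chebRec_le T hlam b p (hsub e he),
      fun e he => (b.abs_deriv_fst_le e (hsub e he)).trans ?_⟩
    have : 1 ≤ ((p : ℝ) + 1) ^ 3 * (lam + 5) := by
      nlinarith [one_le_pow₀ (show (1 : ℝ) ≤ p + 1 by simp) (n := 3)]
    nlinarith

end

/-! ### The trace map of the Sturmian operator. -/

/-- The traces of `M k`, `M (k - 1)` and `M (k - 1) * M k` for the transfer matrices of a Sturmian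
potential whose frequency has partial quotients `a 0, a 1, …`, as functions of the energy. -/
def traceTriple (lam : ℝ) (a : ℕ → ℕ) : ℕ → ℝ → ℝ × ℝ × ℝ
  | 0, e => (e, 2, e - lam)
  | k + 1, e =>
    let T := traceTriple lam a k e
    (chebRec T.1 T.2.1 T.2.2 (a k), T.1, chebRec T.1 T.2.1 T.2.2 (a k + 1))

/-- The trace of `M k`. -/
def traceX (lam : ℝ) (a : ℕ → ℕ) (k : ℕ) (e : ℝ) : ℝ := (traceTriple lam a k e).1

/-- The trace of `M (k - 1)`. -/
def traceY (lam : ℝ) (a : ℕ → ℕ) (k : ℕ) (e : ℝ) : ℝ := (traceTriple lam a k e).2.1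

/-- The trace of `M (k - 1) * M k`. -/
def traceZ (lam : ℝ) (a : ℕ → ℕ) (k : ℕ) (e : ℝ) : ℝ := (traceTriple lam a k e).2.2

/-- The trace of `M (k - 1) * (M k)⁻¹`. -/
def traceW (lam : ℝ) (a : ℕ → ℕ) (k : ℕ) (e : ℝ) : ℝ :=
  traceX lam a k e * traceY lam a k e - traceZ lam a k e

section

variable {lam : ℝ} {a : ℕ → ℕ}

theorem traceX_succ (k : ℕ) : traceX lam a (k + 1) = fun e =>
    chebRec (traceX lam a k e) (traceY lam a k e) (traceZ lam a k e) (a k) := rfl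

theorem traceY_succ (k : ℕ) : traceY lam a (k + 1) = traceX lam a k := rfl

theorem traceZ_succ (k : ℕ) : traceZ lam a (k + 1) = fun e =>
    chebRec (traceX lam a k e) (traceY lam a k e) (traceZ lam a k e) (a k + 1) := rfl

theorem differentiable_chebRec_comp {f g h : ℝ → ℝ} (hf : Differentiable ℝ f)
    (hg : Differentiable ℝ g) (hh : Differentiable ℝ h) :
    ∀ n, Differentiable ℝ fun e => chebRec (f e) (g e) (h e) n
  | 0 => hg
  | 1 => hh
  | n + 2 => (hf.mul (differentiable_chebRec_comp hf hg hh (n + 1))).sub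
      (differentiable_chebRec_comp hf hg hh n)

theorem FrickeTriple.chebRec {f g h : ℝ → ℝ} (T : FrickeTriple lam f g h) (n : ℕ) :
    FrickeTriple lam f (fun e => chebRec (f e) (g e) (h e) n)
      (fun e => chebRec (f e) (g e) (h e) (n + 1)) where
  diff_fst := T.diff_fst
  diff_snd := differentiable_chebRec_comp T.diff_fst T.diff_snd T.diff_trd n
  diff_trd := differentiable_chebRec_comp T.diff_fst T.diff_snd T.diff_trd (n + 1)
  fricke e := by rw [chebRec_fricke, T.fricke]

theorem FrickeTriple.swap₁₂ {f g h : ℝ → ℝ} (T : FrickeTriple lam f g h) :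
    FrickeTriple lam g f h :=
  ⟨T.diff_snd, T.diff_fst, T.diff_trd, fun e => by rw [← T.fricke e]; ring⟩

theorem FrickeTriple.swap₁₃ {f g h : ℝ → ℝ} (T : FrickeTriple lam f g h) :
    FrickeTriple lam h g f :=
  ⟨T.diff_trd, T.diff_snd, T.diff_fst, fun e => by rw [← T.fricke e]; ring⟩

theorem frickeTriple_trace (lam : ℝ) (a : ℕ → ℕ) (k : ℕ) :
    FrickeTriple lam (traceX lam a k) (traceY lam a k) (traceZ lam a k) := by
  induction k with
  | zero =>
    exact ⟨differentiable_id, differentiable_const 2, differentiable_id.sub_const lam, fun e => by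
      simp only [traceX, traceY, traceZ, traceTriple]; ring⟩
  | succ k ih => exact (ih.chebRec (a k)).swap₁₂

theorem frickeTriple_trace' (lam : ℝ) (a : ℕ → ℕ) (k : ℕ) :
    FrickeTriple lam (traceX lam a k) (traceW lam a k) (traceY lam a k) :=
  have T := frickeTriple_trace lam a k
  ⟨T.diff_fst, (T.diff_fst.mul T.diff_snd).sub T.diff_trd, T.diff_snd, fun e => by
    rw [← T.fricke e, traceW]; ring⟩

/-- `M k * (M (k + 1))⁻¹` is conjugate to the inverse of `M (k - 1) * M k ^ (a k - 1)`, and a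
unimodular 2 by 2 matrix has the trace of its inverse. -/
theorem traceW_succ (k n : ℕ) (h : a k = n + 1) : traceW lam a (k + 1) = fun e =>
    chebRec (traceX lam a k e) (traceY lam a k e) (traceZ lam a k e) n := by
  ext e
  rw [traceW, traceX_succ, traceY_succ, traceZ_succ, h]
  simp only [chebRec]
  ring

/-- Starting the sequence one power earlier, at `M (k - 1) * (M k)⁻¹`, shifts the index by one. This
shift gives type II bands one more child of each kind than type III. -/
theorem chebRec_traceW (k n : ℕ) (e : ℝ) :
    chebRec (traceX lam a k e) (traceW lam a k e) (traceY lam a k e) (n + 1) =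
      chebRec (traceX lam a k e) (traceY lam a k e) (traceZ lam a k e) n := by
  rw [chebRec_succ, traceW, sub_sub_cancel]

end

/-! ### Band types and their descendants. -/

/-- The three kinds of spectral bands of periodic approximants. -/
inductive BandType
  | I
  | II
  | III

/-- `[u, v]` contains a band of the given type and level, with traces of derivative at most `D`. -/
def IsBand (lam : ℝ) (a : ℕ → ℕ) : BandType → ℕ → ℝ → ℝ → ℝ → Prop
  | .I, k, u, v, D => BandPair (traceZ lam a k) (traceY lam a k) u v D
  | .II, k, u, v, D => BandPair (traceX lam a k) (traceW lam a k) u v D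
  | .III, k, u, v, D => BandPair (traceX lam a k) (traceY lam a k) u v D

/-- `[u, v]` contains `n` disjoint nondegenerate intervals with property `P`. -/
def Packs (P : ℝ → ℝ → Prop) (u v : ℝ) (n : ℕ) : Prop :=
  ∃ F : Finset (ℝ × ℝ), F.card = n ∧
    (F : Set (ℝ × ℝ)).PairwiseDisjoint (fun I => Set.Icc I.1 I.2) ∧
    ∀ I ∈ F, I.1 ≤ I.2 ∧ u ≤ I.1 ∧ I.2 ≤ v ∧ P I.1 I.2

theorem Packs.single {P : ℝ → ℝ → Prop} {u v : ℝ} (huv : u ≤ v) (h : P u v) : Packs P u v 1 := by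
  refine ⟨{(u, v)}, by simp, by simp, ?_⟩
  intro I hI
  rw [Finset.mem_singleton] at hI
  subst hI
  exact ⟨huv, le_rfl, le_rfl, h⟩

theorem Packs.empty (P : ℝ → ℝ → Prop) (u v : ℝ) : Packs P u v 0 :=
  ⟨∅, by simp, by simp, by simp⟩

theorem Packs.mono_interval {P : ℝ → ℝ → Prop} {u v u' v' : ℝ} {n : ℕ} (h : Packs P u' v' n)
    (hu : u ≤ u') (hv : v' ≤ v) : Packs P u v n := by
  obtain ⟨F, h1, h2, h3⟩ := h
  exact ⟨F, h1, h2, fun I hI => ⟨(h3 I hI).1, hu.trans (h3 I hI).2.1, (h3 I hI).2.2.1.trans hv,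
    (h3 I hI).2.2.2⟩⟩

theorem Packs.biUnion {P : ℝ → ℝ → Prop} {u v : ℝ} (G : Finset (ℝ × ℝ)) (w : ℝ × ℝ → ℕ)
    (hG : (G : Set (ℝ × ℝ)).PairwiseDisjoint (fun I => Set.Icc I.1 I.2))
    (h : ∀ I ∈ G, u ≤ I.1 ∧ I.2 ≤ v ∧ Packs P I.1 I.2 (w I)) :
    Packs P u v (∑ I ∈ G, w I) := by
  classical
  choose! F hF using fun I hI => (h I hI).2.2
  have hsub : ∀ I ∈ G, ∀ J ∈ F I, Set.Icc J.1 J.2 ⊆ Set.Icc I.1 I.2 := fun I hI J hJ =>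
    Set.Icc_subset_Icc ((hF I hI).2.2 J hJ).2.1 ((hF I hI).2.2 J hJ).2.2.1
  refine ⟨G.biUnion F, ?_, ?_, ?_⟩
  · rw [Finset.card_biUnion]
    · exact Finset.sum_congr rfl fun I hI => (hF I hI).1
    · intro I hI J hJ hIJ
      refine Finset.disjoint_left.2 fun K hK hK' => ?_
      have h1 : K.1 ∈ Set.Icc K.1 K.2 := ⟨le_rfl, ((hF I hI).2.2 K hK).1⟩
      exact Set.disjoint_left.1 (hG hI hJ hIJ) (hsub I hI K hK h1) (hsub J hJ K hK' h1)
  · intro A hA B hB hAB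
    simp only [Finset.coe_biUnion, Set.mem_iUnion, Finset.mem_coe, exists_prop] at hA hB
    obtain ⟨I, hI, hA⟩ := hA
    obtain ⟨J, hJ, hB⟩ := hB
    by_cases hIJ : I = J
    · subst hIJ
      exact (hF I hI).2.1 hA hB hAB
    · exact (hG hI hJ hIJ).mono (hsub I hI A hA) (hsub J hJ B hB)
  · intro A hA
    obtain ⟨I, hI, hA⟩ := Finset.mem_biUnion.1 hA
    have := (hF I hI).2.2 A hA
    exact ⟨this.1, (h I hI).1.trans this.2.1, this.2.2.1.trans (h I hI).2.1, this.2.2.2⟩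

section

variable {lam : ℝ} {a : ℕ → ℕ} {k : ℕ} {u v D : ℝ}

theorem exists_typeII_of_typeI (hlam : 20 < lam) (ha : 1 ≤ a k)
    (b : IsBand lam a .I k u v D) : ∃ u' v', u ≤ u' ∧ v' ≤ v ∧
      IsBand lam a .II (k + 1) u' v' ((lam + 9) ^ (a k - 1) * D) := by
  obtain ⟨n, hn⟩ := Nat.exists_eq_add_of_le' ha
  have T := frickeTriple_trace lam a k
  -- Each step replaces the consecutive terms `(t (n + 1), t n)` by `(t (n + 2), t (n + 1))`. From
  -- `(Z, Y)`, `a k - 1` steps reach `(traceX, traceW)` at level `k + 1`.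
  have key : ∀ n, ∃ u' v', u ≤ u' ∧ v' ≤ v ∧ BandPair
      (fun e => chebRec (traceX lam a k e) (traceY lam a k e) (traceZ lam a k e) (n + 1))
      (fun e => chebRec (traceX lam a k e) (traceY lam a k e) (traceZ lam a k e) n) u' v'
      ((lam + 9) ^ n * D) := by
    intro n
    induction n with
    | zero => exact ⟨u, v, le_rfl, le_rfl, by rw [pow_zero, one_mul]; exact b⟩
    | succ n ih =>
      obtain ⟨u', v', h1, h2, h3⟩ := ih
      obtain ⟨u'', v'', h4, h5, h6⟩ := h3.exists_next (T.chebRec n).swap₁₃ hlam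
      refine ⟨u'', v'', h1.trans h4, h5.trans h2, ?_⟩
      rw [pow_succ', mul_assoc]
      exact h6
  obtain ⟨u', v', h1, h2, h3⟩ := key n
  refine ⟨u', v', h1, h2, ?_⟩
  simp only [IsBand]
  rw [traceX_succ, traceW_succ k n hn, hn, Nat.add_sub_cancel]
  exact h3

/-- The contraction cost allowed at level `k`. -/
def stepCost (lam : ℝ) (a : ℕ → ℕ) (k : ℕ) : ℝ := ((a k : ℝ) + 2) ^ 3 * (lam + 5)

theorem stepCost_pos (hlam : 20 < lam) (a : ℕ → ℕ) (k : ℕ) : 1 ≤ stepCost lam a k := by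
  rw [stepCost]
  nlinarith [one_le_pow₀ (show (1 : ℝ) ≤ a k + 2 by linarith [(a k).cast_nonneg (α := ℝ)]) (n := 3)]

/-- Three traces bounded by 2 would give `2 lam ≤ |2 Z - X Y| ≤ 8`. Hence type I and type III
children are disjoint from each other. -/
theorem not_typeI_and_typeIII {e : ℝ} (hlam : 20 < lam) (hX : |traceX lam a k e| ≤ 2)
    (hY : |traceY lam a k e| ≤ 2) (hZ : |traceZ lam a k e| ≤ 2) : False := by
  have := le_abs_two_mul_sub_of_fricke ((frickeTriple_trace lam a k).fricke e) hX hY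
  have h2 := abs_sub (2 * traceZ lam a k e) (traceX lam a k e * traceY lam a k e)
  rw [abs_mul, abs_mul, abs_two] at h2
  nlinarith [abs_nonneg (traceX lam a k e), abs_nonneg (traceY lam a k e)]

theorem packs_of_children {P : ℝ → ℝ → Prop} {n₁ n₃ c₁ c₃ : ℕ} {D' : ℝ} (hlam : 20 < lam)
    (h₁ : ∃ F : Finset (ℝ × ℝ), F.card = n₁ ∧
      (F : Set (ℝ × ℝ)).PairwiseDisjoint (fun I => Set.Icc I.1 I.2) ∧
      ∀ I ∈ F, u ≤ I.1 ∧ I.2 ≤ v ∧ IsBand lam a .I k I.1 I.2 D')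
    (h₃ : ∃ F : Finset (ℝ × ℝ), F.card = n₃ ∧
      (F : Set (ℝ × ℝ)).PairwiseDisjoint (fun I => Set.Icc I.1 I.2) ∧
      ∀ I ∈ F, u ≤ I.1 ∧ I.2 ≤ v ∧ IsBand lam a .III k I.1 I.2 D')
    (hP₁ : ∀ u v, IsBand lam a .I k u v D' → Packs P u v c₁)
    (hP₃ : ∀ u v, IsBand lam a .III k u v D' → Packs P u v c₃) :
    Packs P u v (n₁ * c₁ + n₃ * c₃) := by
  classical
  obtain ⟨F₁, hc₁, hd₁, hF₁⟩ := h₁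
  obtain ⟨F₃, hc₃, hd₃, hF₃⟩ := h₃
  have hcross : ∀ I ∈ F₁, ∀ J ∈ F₃, Disjoint (Set.Icc I.1 I.2) (Set.Icc J.1 J.2) := by
    intro I hI J hJ
    rw [Set.disjoint_left]
    intro e he he'
    exact not_typeI_and_typeIII hlam ((hF₃ J hJ).2.2.crosses.abs_le e he')
      ((hF₁ I hI).2.2.abs_snd_le e he) ((hF₁ I hI).2.2.crosses.abs_le e he)
  have hdisj : Disjoint F₁ F₃ := by
    rw [Finset.disjoint_left]
    intro I hI hI'
    have := hcross I hI I hI'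
    rw [disjoint_self] at this
    exact (Set.nonempty_Icc.2 (hF₁ I hI).2.2.crosses.lt.le).ne_empty this
  have hsum : ∑ I ∈ F₁ ∪ F₃, (if I ∈ F₁ then c₁ else c₃) = n₁ * c₁ + n₃ * c₃ := by
    rw [Finset.sum_union hdisj, Finset.sum_congr rfl (g := fun _ => c₁)
      (fun I hI => by simp [hI]), Finset.sum_congr (s₁ := F₃) rfl (g := fun _ => c₃)
      (fun I hI => by simp [Finset.disjoint_right.1 hdisj hI])]
    simp [hc₁, hc₃]
  rw [← hsum]
  refine Packs.biUnion _ _ ?_ ?_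
  · intro A hA B hB hAB
    rw [Finset.mem_coe, Finset.mem_union] at hA hB
    rcases hA with hA | hA <;> rcases hB with hB | hB
    · exact hd₁ hA hB hAB
    · exact hcross A hA B hB
    · exact (hcross B hB A hA).symm
    · exact hd₃ hA hB hAB
  · intro I hI
    by_cases hI1 : I ∈ F₁
    · have := hF₁ I hI1
      simp only [hI1, if_true]
      exact ⟨this.1, this.2.1, hP₁ _ _ this.2.2⟩
    · have := hF₃ I ((Finset.mem_union.1 hI).resolve_left hI1)
      simp only [hI1, if_false]
      exact ⟨this.1, this.2.1, hP₃ _ _ this.2.2⟩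

/-- A lower count of the bands `m` levels below a band of the given type at level `k`. -/
def descCount (a : ℕ → ℕ) : ℕ → ℕ → BandType → ℕ
  | 0, _, _ => 1
  -- For `a k ≥ 3` the type II child costs `(lam + 9) ^ (a k - 1)`, which need not fit within
  -- `stepCost`, so it is not counted.
  | m + 1, k, .I => if a k ≤ 2 then descCount a m (k + 1) .II else 0
  | m + 1, k, .II =>
    (a k + 1) * descCount a m (k + 1) .I + a k * descCount a m (k + 1) .III
  | m + 1, k, .III =>
    a k * descCount a m (k + 1) .I + (a k - 1) * descCount a m (k + 1) .III

theorem cost_le {p : ℕ} (hlam : 20 < lam) (hp : p ≤ a k + 1) (hD : 0 ≤ D) :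
    ((p : ℝ) + 1) ^ 3 * (lam + 5) * D ≤ stepCost lam a k * D := by
  have : (p : ℝ) ≤ a k + 1 := by exact_mod_cast hp
  rw [stepCost]
  have h5 : 0 ≤ lam + 5 := by linarith
  have : (p : ℝ) + 1 ≤ a k + 2 := by linarith
  gcongr

theorem IsBand.children_II (hlam : 20 < lam)
    (b : IsBand lam a .II k u v D) :
    (∃ F : Finset (ℝ × ℝ), F.card = a k + 1 ∧
      (F : Set (ℝ × ℝ)).PairwiseDisjoint (fun I => Set.Icc I.1 I.2) ∧
      ∀ I ∈ F, u ≤ I.1 ∧ I.2 ≤ v ∧ IsBand lam a .I (k + 1) I.1 I.2 (stepCost lam a k * D)) ∧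
    (∃ F : Finset (ℝ × ℝ), F.card = a k ∧
      (F : Set (ℝ × ℝ)).PairwiseDisjoint (fun I => Set.Icc I.1 I.2) ∧
      ∀ I ∈ F, u ≤ I.1 ∧ I.2 ≤ v ∧ IsBand lam a .III (k + 1) I.1 I.2 (stepCost lam a k * D)) := by
  have T := frickeTriple_trace' lam a k
  have hD : 0 ≤ D := BandPair.nonneg b
  constructor
  · obtain ⟨F, h1, h2, h3⟩ := BandPair.exists_chebRec T hlam b (a k + 1)
    refine ⟨F, h1, h2, fun I hI => ⟨(h3 I hI).1, (h3 I hI).2.1, ?_⟩⟩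
    have := (h3 I hI).2.2
    simp only [chebRec_traceW] at this
    exact this.mono (cost_le hlam le_rfl hD)
  · obtain ⟨F, h1, h2, h3⟩ := BandPair.exists_chebRec T hlam b (a k)
    refine ⟨F, h1, h2, fun I hI => ⟨(h3 I hI).1, (h3 I hI).2.1, ?_⟩⟩
    have := (h3 I hI).2.2
    simp only [chebRec_traceW] at this
    exact this.mono (cost_le hlam (Nat.le_succ _) hD)

theorem IsBand.children_III (hlam : 20 < lam) (ha : 1 ≤ a k)
    (b : IsBand lam a .III k u v D) :
    (∃ F : Finset (ℝ × ℝ), F.card = a k ∧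
      (F : Set (ℝ × ℝ)).PairwiseDisjoint (fun I => Set.Icc I.1 I.2) ∧
      ∀ I ∈ F, u ≤ I.1 ∧ I.2 ≤ v ∧ IsBand lam a .I (k + 1) I.1 I.2 (stepCost lam a k * D)) ∧
    (∃ F : Finset (ℝ × ℝ), F.card = a k - 1 ∧
      (F : Set (ℝ × ℝ)).PairwiseDisjoint (fun I => Set.Icc I.1 I.2) ∧
      ∀ I ∈ F, u ≤ I.1 ∧ I.2 ≤ v ∧ IsBand lam a .III (k + 1) I.1 I.2 (stepCost lam a k * D)) := by
  have T := frickeTriple_trace lam a k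
  have hD : 0 ≤ D := BandPair.nonneg b
  constructor
  · obtain ⟨F, h1, h2, h3⟩ := BandPair.exists_chebRec T hlam b (a k)
    exact ⟨F, h1, h2, fun I hI => ⟨(h3 I hI).1, (h3 I hI).2.1,
      (h3 I hI).2.2.mono (cost_le hlam (Nat.le_succ _) hD)⟩⟩
  · obtain ⟨F, h1, h2, h3⟩ := BandPair.exists_chebRec T hlam b (a k - 1)
    refine ⟨F, h1, h2, fun I hI => ⟨(h3 I hI).1, (h3 I hI).2.1, ?_⟩⟩
    have := (h3 I hI).2.2.mono (cost_le (a := a) (k := k) hlam (by omega) hD)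
    rw [Nat.sub_add_cancel ha] at this
    exact this

theorem IsBand.lt {τ : BandType} (b : IsBand lam a τ k u v D) : u < v := by
  cases τ <;> exact BandPair.crosses b |>.lt

theorem IsBand.four_le {τ : BandType} (b : IsBand lam a τ k u v D) : 4 ≤ D * (v - u) := by
  have T := frickeTriple_trace lam a k
  cases τ
  · exact BandPair.four_le T.diff_trd b
  · exact BandPair.four_le T.diff_fst b
  · exact BandPair.four_le T.diff_fst b

theorem IsBand.packs_desc (hlam : 20 < lam) (ha : ∀ k, 1 ≤ a k) (m : ℕ) :
    ∀ {k : ℕ} {τ : BandType} {u v D : ℝ}, IsBand lam a τ k u v D →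
      Packs (fun u v => ∃ τ, IsBand lam a τ (k + m) u v
        ((∏ i ∈ Finset.range m, stepCost lam a (k + i)) * D)) u v (descCount a m k τ) := by
  induction m with
  | zero => exact fun {k τ u v D} b => .single b.lt.le ⟨τ, by simpa using b⟩
  | succ m ih =>
    intro k τ u v D b
    have hprod : ∀ D, (∏ i ∈ Finset.range (m + 1), stepCost lam a (k + i)) * D =
        (∏ i ∈ Finset.range m, stepCost lam a (k + 1 + i)) * (stepCost lam a k * D) := by
      intro D
      rw [Finset.prod_range_succ', ← mul_assoc]
      simp [add_assoc, add_comm 1]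
    rw [hprod, show k + (m + 1) = k + 1 + m by ring]
    cases τ with
    | I =>
      rw [descCount]
      split_ifs with h2
      · obtain ⟨u', v', h1, h3, h4⟩ := exists_typeII_of_typeI hlam (ha k) b
        have hD : 0 ≤ D := BandPair.nonneg b
        have h5 : 1 ≤ a k := ha k
        have hcost : (lam + 9) ^ (a k - 1) * D ≤ stepCost lam a k * D := by
          refine mul_le_mul_of_nonneg_right ?_ hD
          rw [stepCost]
          interval_cases h : a k
          · norm_num; linarith
          · norm_num; linarith
        have h6 : IsBand lam a .II (k + 1) u' v' (stepCost lam a k * D) := BandPair.mono h4 hcost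
        exact (ih h6).mono_interval h1 h3
      · exact .empty _ _ _
    | II =>
      obtain ⟨h1, h3⟩ := b.children_II hlam
      exact packs_of_children hlam h1 h3 (fun _ _ h => ih h) (fun _ _ h => ih h)
    | III =>
      obtain ⟨h1, h3⟩ := b.children_III hlam (ha k)
      exact packs_of_children hlam h1 h3 (fun _ _ h => ih h) (fun _ _ h => ih h)

/-- Energies in a band at which the traces stay bounded for `m` further levels. -/
theorem IsBand.exists_finite_bounded (hlam : 20 < lam) (ha : ∀ k, 1 ≤ a k) (m : ℕ) :
    ∀ {k : ℕ} {τ : BandType} {u v D : ℝ}, IsBand lam a τ k u v D →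
      ∃ e ∈ Set.Icc u v, ∀ j < m,
        |traceX lam a (k + j) e| ≤ 2 ∨ |traceX lam a (k + j + 1) e| ≤ 2 := by
  induction m with
  | zero => exact fun b => ⟨_, ⟨le_rfl, b.lt.le⟩, by simp⟩
  | succ m ih =>
    intro k τ u v D b
    have step : ∀ {τ' : BandType} {u' v' D' : ℝ}, IsBand lam a τ' (k + 1) u' v' D' → u ≤ u' →
        v' ≤ v → (∀ e ∈ Set.Icc u' v', |traceX lam a k e| ≤ 2 ∨ |traceX lam a (k + 1) e| ≤ 2) →
        ∃ e ∈ Set.Icc u v, ∀ j < m + 1,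
          |traceX lam a (k + j) e| ≤ 2 ∨ |traceX lam a (k + j + 1) e| ≤ 2 := by
      intro τ' u' v' D' b' hu hv h
      obtain ⟨e, he, h'⟩ := ih b'
      refine ⟨e, ⟨hu.trans he.1, he.2.trans hv⟩, fun j hj => ?_⟩
      cases j with
      | zero => exact h e he
      | succ j => simpa [add_assoc, add_comm 1] using h' j (by omega)
    cases τ with
    | I =>
      -- No cost matters here, so the type II child is available for every `a k`; `X` may be large
      -- at level `k` but is bounded at level `k + 1`.
      obtain ⟨u', v', h1, h3, h4⟩ := exists_typeII_of_typeI hlam (ha k) b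
      exact step h4 h1 h3 fun e he => .inr (BandPair.crosses h4 |>.abs_le e he)
    | II =>
      obtain ⟨⟨F, h1, -, h2⟩, -⟩ := b.children_II hlam
      obtain ⟨I, hI⟩ := Finset.card_pos.1 (by rw [h1]; exact Nat.succ_pos _)
      obtain ⟨h3, h4, h5⟩ := h2 I hI
      exact step h5 h3 h4 fun e he => .inl (BandPair.crosses b |>.abs_le e
        ⟨h3.trans he.1, he.2.trans h4⟩)
    | III =>
      obtain ⟨⟨F, h1, -, h2⟩, -⟩ := b.children_III hlam (ha k)
      obtain ⟨I, hI⟩ := Finset.card_pos.1 (by rw [h1]; exact ha k)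
      obtain ⟨h3, h4, h5⟩ := h2 I hI
      exact step h5 h3 h4 fun e he => .inl (BandPair.crosses b |>.abs_le e
        ⟨h3.trans he.1, he.2.trans h4⟩)

/-- Compactness: the sets of energies that survive `m` levels are nested, compact and nonempty. -/
theorem IsBand.exists_bounded (hlam : 20 < lam) (ha : ∀ k, 1 ≤ a k) {τ : BandType}
    (b : IsBand lam a τ k u v D) : ∃ e ∈ Set.Icc u v, ∀ j,
      |traceX lam a (k + j) e| ≤ 2 ∨ |traceX lam a (k + j + 1) e| ≤ 2 := by
  let A : ℕ → Set ℝ := fun m => Set.Icc u v ∩ ⋂ j, ⋂ (_ : j < m),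
    {e | |traceX lam a (k + j) e| ≤ 2 ∨ |traceX lam a (k + j + 1) e| ≤ 2}
  have hcl : ∀ j, IsClosed {e | |traceX lam a j e| ≤ 2} := fun j =>
    isClosed_le (frickeTriple_trace lam a j).diff_fst.continuous.abs continuous_const
  have hclosed : ∀ m, IsClosed (A m) := fun m => isClosed_Icc.inter <|
    isClosed_iInter fun j => isClosed_iInter fun _ => (hcl (k + j)).union (hcl (k + j + 1))
  have hne : (⋂ m, A m).Nonempty := by
    refine IsCompact.nonempty_iInter_of_sequence_nonempty_isCompact_isClosed A ?_ ?_ ?_ hclosed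
    · intro m e he
      refine ⟨he.1, ?_⟩
      have := he.2
      simp only [Set.mem_iInter] at this ⊢
      exact fun j hj => this j (by omega)
    · intro m
      obtain ⟨e, he, h⟩ := b.exists_finite_bounded hlam ha m
      exact ⟨e, he, by simpa only [Set.mem_iInter, Set.mem_ofPred_eq] using h⟩
    · exact isCompact_Icc.of_isClosed_subset (hclosed 0) Set.inter_subset_left
  obtain ⟨e, he⟩ := hne
  rw [Set.mem_iInter] at he
  refine ⟨e, (he 0).1, fun j => ?_⟩
  have := (he (j + 1)).2
  simp only [Set.mem_iInter] at this
  exact this j (Nat.lt_succ_self j)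

theorem isBand_zero (lam : ℝ) (a : ℕ → ℕ) : IsBand lam a .I 0 (lam - 2) (lam + 2) 1 := by
  have hY : traceY lam a 0 = fun _ => 2 := rfl
  have hZ : traceZ lam a 0 = fun e => e - lam := rfl
  simp only [IsBand]
  rw [hY, hZ]
  refine ⟨⟨by linarith, fun e he => ?_, .inr ⟨by ring, by ring⟩⟩, ?_, ?_, ?_⟩
  · rw [abs_le]; constructor <;> linarith [he.1, he.2]
  · simp
  · simp
  · simp

end

/-! ### Golden ratio growth of the band count. -/

open Real in
/-- The count of descendants of a type II band grows at least like a power of the golden ratio. -/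
theorem goldenRatio_pow_le_descCount {a : ℕ → ℕ} (ha : ∀ k, 1 ≤ a k) (m k : ℕ) :
    goldenRatio ^ m ≤ descCount a m k .II := by
  have hφ := goldenRatio_sq
  have hφ1 := one_lt_goldenRatio
  have hφ2 := goldenRatio_lt_two
  set φ := goldenRatio with hφdef
  have hlow : 3 / 2 ≤ φ := by nlinarith
  have hφ3 : φ ^ 3 = 2 * φ + 1 := by linear_combination (φ + 1) * hφ
  have hφ4 : φ ^ 4 = 3 * φ + 2 := by linear_combination (φ ^ 2 + φ + 2) * hφ
  -- Up to the factor `c`, the counts (I, II, III) dominate `(φ, φ², 1)`, `(0, φ³, φ³)` or `(φ², φ²,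
  -- 0)`. The first is the eigenvector for digit 1. Prepending a digit `a k ≥ 3` leads to the
  -- second, digit 1 takes the second to the third, and all other cases return to the first; `c` is
  -- multiplied by `φ` each time.
  have key : ∀ m k, ∃ c : ℝ, φ ^ m = φ ^ 2 * c ∧ 0 < c ∧
      ((φ * c ≤ descCount a m k .I ∧ φ ^ 2 * c ≤ descCount a m k .II ∧
        c ≤ descCount a m k .III) ∨
      (φ ^ 3 * c ≤ descCount a m k .II ∧ φ ^ 3 * c ≤ descCount a m k .III) ∨
      (φ ^ 2 * c ≤ descCount a m k .I ∧ φ ^ 2 * c ≤ descCount a m k .II)) := by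
    intro m
    induction m with
    | zero =>
      intro k
      refine ⟨1 / φ ^ 2, by field_simp, by positivity, .inl ?_⟩
      simp only [descCount, Nat.cast_one]
      refine ⟨?_, by field_simp; rfl, ?_⟩ 
      · rw [mul_one_div, div_le_one (by positivity)]; nlinarith
      · rw [div_le_one (by positivity)]; nlinarith
    | succ m ih =>
      intro k
      obtain ⟨c, hc, hc0, h⟩ := ih (k + 1)
      refine ⟨φ * c, by rw [pow_succ, hc]; ring, by positivity, ?_⟩
      simp only [descCount]
      set x : ℝ := (descCount a m (k + 1) .I : ℝ) with hx
      set y : ℝ := (descCount a m (k + 1) .II : ℝ) with hy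
      set z : ℝ := (descCount a m (k + 1) .III : ℝ) with hz
      have hx0 : 0 ≤ x := by positivity
      have hy0 : 0 ≤ y := by positivity
      have hz0 : 0 ≤ z := by positivity
      rw [hφ3] at h
      rw [hφ] at h
      have e1 : φ * (φ * c) = φ * c + c := by linear_combination c * hφ
      have e2 : φ ^ 2 * (φ * c) = 2 * (φ * c) + c := by linear_combination c * hφ3
      have e3 : φ ^ 3 * (φ * c) = 3 * (φ * c) + 2 * c := by linear_combination c * hφ4
      rw [e1, e2, e3]
      have hd0 : 0 < φ * c := by positivity
      rw [show (φ + 1) * c = φ * c + c by ring, show (2 * φ + 1) * c = 2 * (φ * c) + c by ring] at h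
      generalize φ * c = d at h hd0 ⊢
      have h1 := ha k
      rcases Nat.lt_or_ge 2 (a k) with h2 | h2
      · rw [if_neg (by omega)]
        have hak : (3 : ℝ) ≤ a k := by exact_mod_cast h2
        refine .inr (.inl ?_)
        push_cast [Nat.cast_sub h1]
        rw [← hx, ← hz]
        have b1 : 4 * x + 3 * z ≤ (a k + 1) * x + a k * z := by nlinarith only [hak, hx0, hz0]
        have b2 : 3 * x + 2 * z ≤ a k * x + (a k - 1) * z := by nlinarith only [hak, hx0, hz0]
        rcases h with ⟨g1, g2, g3⟩ | ⟨g2, g3⟩ | ⟨g1, g2⟩ <;> constructor <;> linarith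
      · obtain h2 | h2 : a k = 1 ∨ a k = 2 := by omega
        · rw [h2]
          norm_num
          rw [← hx, ← hy, ← hz]
          rcases h with ⟨g1, g2, g3⟩ | ⟨g2, g3⟩ | ⟨g1, g2⟩
          · exact .inl ⟨by linarith, by linarith, by linarith⟩
          · exact .inr (.inr ⟨by linarith, by linarith⟩)
          · exact .inl ⟨by linarith, by linarith, by linarith⟩
        · rw [h2]
          norm_num
          rw [← hx, ← hy, ← hz]
          rcases h with ⟨g1, g2, g3⟩ | ⟨g2, g3⟩ | ⟨g1, g2⟩ <;>
            exact .inl ⟨by linarith, by linarith, by linarith⟩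
  obtain ⟨c, hc, hc0, h⟩ := key m k
  rw [hc]
  rcases h with h | h | h
  · exact h.2.1
  · refine le_trans ?_ h.1
    gcongr <;> linarith
  · exact h.2

/-! ### Continued fractions and near-periods of the potential. -/

/-- The iterates of the Gauss map. -/
noncomputable def gaussIter (β : ℝ) : ℕ → ℝ
  | 0 => Int.fract β
  | k + 1 => Int.fract (gaussIter β k)⁻¹

/-- The partial quotients, indexed from `0`. -/
noncomputable def cfDigit (β : ℝ) (k : ℕ) : ℕ := ⌊(gaussIter β k)⁻¹⌋₊

/-- The denominators of the convergents; index `k + 1` belongs to the `k`-th convergent. -/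
def cfDen (a : ℕ → ℕ) : ℕ → ℕ
  | 0 => 0
  | 1 => 1
  | k + 2 => cfDen a k + a k * cfDen a (k + 1)

/-- The numerators of the convergents; index `k + 1` belongs to the `k`-th convergent. -/
def cfNum (a : ℕ → ℕ) : ℕ → ℕ
  | 0 => 1
  | 1 => 0
  | k + 2 => cfNum a k + a k * cfNum a (k + 1)

section

variable {β : ℝ}

theorem irrational_gaussIter (hirr : Irrational β) : ∀ k, Irrational (gaussIter β k)
  | 0 => by
    rw [gaussIter, Int.fract]
    exact hirr.sub_intCast _
  | k + 1 => by
    rw [gaussIter, Int.fract]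
    exact (irrational_gaussIter hirr k).inv.sub_intCast _

theorem gaussIter_pos (hirr : Irrational β) (k : ℕ) : 0 < gaussIter β k := by
  refine lt_of_le_of_ne ?_ (irrational_gaussIter hirr k).ne_zero.symm
  cases k <;> exact Int.fract_nonneg _

theorem gaussIter_lt_one (β : ℝ) (k : ℕ) : gaussIter β k < 1 := by
  cases k <;> exact Int.fract_lt_one _

theorem one_le_cfDigit (hirr : Irrational β) (k : ℕ) : 1 ≤ cfDigit β k := by
  rw [cfDigit, Nat.one_le_floor_iff]
  exact (one_le_inv₀ (gaussIter_pos hirr k)).2 (gaussIter_lt_one β k).le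

theorem cfDigit_eq_floor (hirr : Irrational β) (k : ℕ) :
    (cfDigit β k : ℤ) = ⌊(gaussIter β k)⁻¹⌋ :=
  Int.natCast_floor_eq_floor (inv_pos.2 (gaussIter_pos hirr k)).le

theorem gaussIter_succ (hirr : Irrational β) (k : ℕ) :
    gaussIter β (k + 1) = (gaussIter β k)⁻¹ - cfDigit β k := by
  rw [gaussIter, Int.fract, ← cfDigit_eq_floor hirr, Int.cast_natCast]

theorem exists_stream_eq (hirr : Irrational β) (k : ℕ) :
    ∃ b, GenContFract.IntFractPair.stream β k = some ⟨b, gaussIter β k⟩ := by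
  induction k with
  | zero => exact ⟨_, rfl⟩
  | succ k ih =>
    obtain ⟨b, hb⟩ := ih
    exact ⟨_, GenContFract.IntFractPair.stream_succ_of_some hb (gaussIter_pos hirr k).ne'⟩

theorem partialQuotient_succ (hirr : Irrational β) (k : ℕ) :
    partialQuotient β (k + 1) = cfDigit β k := by
  obtain ⟨b, hb⟩ := exists_stream_eq hirr k
  have h := GenContFract.get?_of_eq_some_of_get?_intFractPair_stream_fr_ne_zero hb
    (gaussIter_pos hirr k).ne'
  rw [partialQuotient, Nat.add_sub_cancel, GenContFract.partDen_eq_s_b h, Option.getD_some]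
  simp only [GenContFract.IntFractPair.of]
  rw [← cfDigit_eq_floor hirr, Int.cast_natCast]

theorem one_le_cfDen {a : ℕ → ℕ} (ha : ∀ k, 1 ≤ a k) : ∀ k, 1 ≤ cfDen a (k + 1)
  | 0 => le_rfl
  | k + 1 => by
    rw [cfDen]
    nlinarith [one_le_cfDen ha k, ha k]

theorem cfDen_add_le {a : ℕ → ℕ} (ha : ∀ k, 1 ≤ a k) (k : ℕ) :
    cfDen a k + cfDen a (k + 1) ≤ cfDen a (k + 2) := by
  rw [cfDen]
  nlinarith [ha k]

theorem two_le_cfDen {a : ℕ → ℕ} (ha : ∀ k, 1 ≤ a k) (k : ℕ) : 2 ≤ cfDen a (k + 3) := by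
  have := cfDen_add_le ha (k + 1)
  have h1 := one_le_cfDen ha k
  have h2 := one_le_cfDen ha (k + 1)
  exact (Nat.add_le_add h1 h2).trans this

theorem le_cfDen {a : ℕ → ℕ} (ha : ∀ k, 1 ≤ a k) (k : ℕ) : k ≤ cfDen a (k + 1) := by
  induction k with
  | zero => exact Nat.zero_le _
  | succ k ih =>
    have := cfDen_add_le ha k
    cases k with
    | zero => exact one_le_cfDen ha 1
    | succ k =>
      have h1 := one_le_cfDen ha k
      exact (Nat.add_le_add h1 ih).trans' (by omega) |>.trans this

theorem cf_det (a : ℕ → ℕ) (k : ℕ) :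
    (cfDen a (k + 1) * cfNum a k - cfDen a k * cfNum a (k + 1) : ℤ) = (-1) ^ k := by
  induction k with
  | zero => simp [cfDen, cfNum]
  | succ k ih =>
    rw [cfDen, cfNum, pow_succ, ← ih]
    push_cast
    ring

theorem cf_error_succ (hirr : Irrational β) (hβ : β ∈ Set.Icc (0 : ℝ) 1) (k : ℕ) :
    cfDen (cfDigit β) (k + 1) * β - cfNum (cfDigit β) (k + 1) =
      -gaussIter β k * (cfDen (cfDigit β) k * β - cfNum (cfDigit β) k) := by
  induction k with
  | zero =>
    have : Int.fract β = β := Int.fract_eq_self.2 ⟨hβ.1, lt_of_le_of_ne hβ.2 hirr.ne_one⟩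
    simp [cfDen, cfNum, gaussIter, this]
  | succ k ih =>
    have h0 := (gaussIter_pos hirr k).ne'
    have h1 : cfDen (cfDigit β) k * β - cfNum (cfDigit β) k =
        -(gaussIter β k)⁻¹ *
          (cfDen (cfDigit β) (k + 1) * β - cfNum (cfDigit β) (k + 1)) := by
      rw [ih]; field_simp
    rw [cfDen, cfNum, gaussIter_succ hirr]
    push_cast
    linear_combination h1

theorem cf_error_ne_zero (hirr : Irrational β) (hβ : β ∈ Set.Icc (0 : ℝ) 1) (k : ℕ) :
    cfDen (cfDigit β) k * β - cfNum (cfDigit β) k ≠ 0 := by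
  induction k with
  | zero => simp [cfDen, cfNum]
  | succ k ih =>
    rw [cf_error_succ hirr hβ]
    exact mul_ne_zero (neg_ne_zero.2 (gaussIter_pos hirr k).ne') ih

theorem cf_error_mul_neg (hirr : Irrational β) (hβ : β ∈ Set.Icc (0 : ℝ) 1) (k : ℕ) :
    (cfDen (cfDigit β) k * β - cfNum (cfDigit β) k) *
      (cfDen (cfDigit β) (k + 1) * β - cfNum (cfDigit β) (k + 1)) < 0 := by
  rw [cf_error_succ hirr hβ]
  have h1 := gaussIter_pos hirr k
  have h2 := sq_pos_of_ne_zero (cf_error_ne_zero hirr hβ k)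
  nlinarith [mul_pos h1 h2]

/-- The best approximation property of the convergents. -/
theorem cf_best_approx (hirr : Irrational β) (hβ : β ∈ Set.Icc (0 : ℝ) 1) (k : ℕ) (n m : ℤ)
    (hn : 0 < n) (hn' : n < cfDen (cfDigit β) (k + 1)) :
    |cfDen (cfDigit β) k * β - cfNum (cfDigit β) k| ≤ |n * β - m| := by
  have hdet := cf_det (cfDigit β) k
  have hneg := cf_error_mul_neg hirr hβ k
  have hq : (0 : ℤ) ≤ cfDen (cfDigit β) k := Int.natCast_nonneg _
  have hq' : (0 : ℤ) < cfDen (cfDigit β) (k + 1) := hn.trans hn'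
  set q : ℤ := (cfDen (cfDigit β) k : ℤ)
  set q' : ℤ := (cfDen (cfDigit β) (k + 1) : ℤ)
  set p : ℤ := (cfNum (cfDigit β) k : ℤ)
  set p' : ℤ := (cfNum (cfDigit β) (k + 1) : ℤ)
  have hs : ((-1 : ℤ) ^ k) * (-1) ^ k = 1 := by rw [← mul_pow]; simp
  -- Coordinates in the unimodular basis of two consecutive convergents. Since `0 < n < q'`, `x ≠ 0`
  -- and `x y ≤ 0`; the two errors have opposite signs, so their contributions do not cancel.
  obtain ⟨x, y, hx, hy⟩ : ∃ x y : ℤ, n = x * q + y * q' ∧ m = x * p + y * p' := by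
    refine ⟨(-1) ^ k * (q' * m - p' * n), (-1) ^ k * (p * n - q * m), ?_, ?_⟩
    · linear_combination (-n * (-1) ^ k) * hdet - n * hs
    · linear_combination (-m * (-1) ^ k) * hdet - m * hs
  have hx0 : x ≠ 0 := by
    rintro rfl
    rw [zero_mul, zero_add] at hx
    have hy0 : 0 < y := by by_contra! h; nlinarith
    nlinarith
  have hxy : x * y ≤ 0 := by
    by_contra! h
    rcases mul_pos_iff.1 h with ⟨h1, h2⟩ | ⟨h1, h2⟩ <;> nlinarith
  have e : (n : ℝ) * β - m = x * (q * β - p) + y * (q' * β - p') := by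
    rw [hx, hy]; push_cast; ring
  have c1 : ((cfDen (cfDigit β) k : ℕ) : ℝ) = (q : ℝ) := (Int.cast_natCast _).symm
  have c2 : ((cfDen (cfDigit β) (k + 1) : ℕ) : ℝ) = (q' : ℝ) := (Int.cast_natCast _).symm
  have c3 : ((cfNum (cfDigit β) k : ℕ) : ℝ) = (p : ℝ) := (Int.cast_natCast _).symm
  have c4 : ((cfNum (cfDigit β) (k + 1) : ℕ) : ℝ) = (p' : ℝ) := (Int.cast_natCast _).symm
  rw [c1, c2, c3, c4] at hneg
  rw [e, c1, c3]
  have hx1 : (1 : ℝ) ≤ x ^ 2 := by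
    have h1 : 0 < x ^ 2 := by positivity
    exact_mod_cast h1
  have hxy' : (x : ℝ) * y ≤ 0 := by exact_mod_cast hxy
  refine sq_le_sq.1 ?_
  have h1 := mul_nonneg_of_nonpos_of_nonpos hxy' hneg.le
  nlinarith [sq_nonneg ((y : ℝ) * (q' * β - p')), mul_nonneg (sub_nonneg.2 hx1)
    (sq_nonneg ((q : ℝ) * β - p))]

/-- By best approximation, the shift moves `n β` modulo 1 by no more than its distance to either
neighbouring integer. Irrationality excludes landing on the upper one. -/
theorem floor_add_cfDen_mul (hirr : Irrational β) (hβ : β ∈ Set.Icc (0 : ℝ) 1) (k n : ℕ)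
    (hn : 1 ≤ n) (hn' : n < cfDen (cfDigit β) (k + 1)) :
    ⌊((n + cfDen (cfDigit β) k : ℕ) : ℝ) * β⌋ = ⌊(n : ℝ) * β⌋ + cfNum (cfDigit β) k := by
  have h1 := cf_best_approx hirr hβ k n ⌊(n : ℝ) * β⌋ (by exact_mod_cast hn)
    (by exact_mod_cast hn')
  have h2 := cf_best_approx hirr hβ k n (⌊(n : ℝ) * β⌋ + 1) (by exact_mod_cast hn)
    (by exact_mod_cast hn')
  push_cast at h1 h2
  have f1 := Int.floor_le ((n : ℝ) * β)
  have f2 := Int.lt_floor_add_one ((n : ℝ) * β)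
  rw [abs_of_nonneg (sub_nonneg.2 f1)] at h1
  rw [abs_of_neg (a := (n : ℝ) * β - (⌊(n : ℝ) * β⌋ + 1)) (by linarith)] at h2
  have h3 := abs_le.1 h1
  have h4 := abs_le.1 h2
  have hne : ((n + cfDen (cfDigit β) k : ℕ) : ℝ) * β ≠
      ((⌊(n : ℝ) * β⌋ + cfNum (cfDigit β) k + 1 : ℤ) : ℝ) :=
    (hirr.natCast_mul (by omega)).ne_int _
  rw [Int.floor_eq_iff]
  push_cast at hne ⊢
  refine ⟨by linarith [h3.1, h4.1], lt_of_le_of_ne (by linarith [h3.2, h4.2]) hne⟩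

end

theorem sturmianPotential_natCast (lam β : ℝ) (n : ℕ) : sturmianPotential lam β (n : ℤ) =
    lam * ((⌊((n + 1 : ℕ) : ℝ) * β⌋ : ℝ) - (⌊(n : ℝ) * β⌋ : ℝ)) := by
  simp [sturmianPotential]

theorem sturmianPotential_add_cfDen {lam β : ℝ} (hirr : Irrational β)
    (hβ : β ∈ Set.Icc (0 : ℝ) 1) (k n : ℕ) (hn : 1 ≤ n)
    (hn' : n + 1 < cfDen (cfDigit β) (k + 1)) :
    sturmianPotential lam β ((n + cfDen (cfDigit β) k : ℕ) : ℤ) =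
      sturmianPotential lam β (n : ℤ) := by
  rw [sturmianPotential_natCast, sturmianPotential_natCast, add_right_comm n _ 1,
    floor_add_cfDen_mul hirr hβ k n hn (by omega),
    floor_add_cfDen_mul hirr hβ k (n + 1) (by omega) hn']
  push_cast
  ring

/-! ### Transfer matrices over convergent denominators. -/

/-- The one-step transfer matrix at energy `e` and potential `c`. -/
def transferStep (e c : ℝ) : Matrix (Fin 2) (Fin 2) ℝ := !![e - c, -1; 1, 0]

/-- The transfer matrix from `1` to `n + 1` for the potential `V`. -/
def transferProd (V : ℕ → ℝ) (e : ℝ) : ℕ → Matrix (Fin 2) (Fin 2) ℝ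
  | 0 => 1
  | n + 1 => transferStep e (V (n + 1)) * transferProd V e n

theorem transferProd_add {V : ℕ → ℝ} {e : ℝ} {q : ℕ} (r : ℕ)
    (h : ∀ n, 1 ≤ n → n ≤ r → V (n + q) = V n) :
    transferProd V e (r + q) = transferProd V e r * transferProd V e q := by
  induction r with
  | zero => simp [transferProd]
  | succ r ih =>
    rw [show r + 1 + q = r + q + 1 by ring, transferProd, transferProd,
      ih fun n h1 h2 => h n h1 (h2.trans (Nat.le_succ r)), show r + q + 1 = r + 1 + q by ring,
      h (r + 1) (by omega) le_rfl, mul_assoc]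

theorem transferProd_const {V : ℕ → ℝ} {e c : ℝ} (r : ℕ) (h : ∀ n, 1 ≤ n → n ≤ r → V n = c) :
    transferProd V e r = transferStep e c ^ r := by
  induction r with
  | zero => simp [transferProd]
  | succ r ih =>
    rw [transferProd, ih fun n h1 h2 => h n h1 (h2.trans (Nat.le_succ r)),
      h (r + 1) (by omega) le_rfl, pow_succ']

/-- The pair `(M (k - 1), M k)` of transfer matrices given by the partial quotients. -/
def matrixPair (lam : ℝ) (a : ℕ → ℕ) (e : ℝ) :
    ℕ → Matrix (Fin 2) (Fin 2) ℝ × Matrix (Fin 2) (Fin 2) ℝ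
  -- The first matrix is formal: its product with the step at potential 0 is the step at potential
  -- `lam`.
  | 0 => (!![1, -lam; 0, 1], transferStep e 0)
  | k + 1 =>
    ((matrixPair lam a e k).2, (matrixPair lam a e k).1 * (matrixPair lam a e k).2 ^ a k)

theorem det_matrixPair (lam : ℝ) (a : ℕ → ℕ) (e : ℝ) (k : ℕ) :
    (matrixPair lam a e k).1.det = 1 ∧ (matrixPair lam a e k).2.det = 1 := by
  induction k with
  | zero => simp [matrixPair, transferStep, Matrix.det_fin_two]
  | succ k ih => simp [matrixPair, ih.1, ih.2]

theorem Matrix.sq_eq_of_det_eq_one {A : Matrix (Fin 2) (Fin 2) ℝ} (h : A.det = 1) :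
    A * A = A.trace • A - 1 := by
  rw [Matrix.det_fin_two] at h
  ext i j
  fin_cases i <;> fin_cases j <;>
    simp [Matrix.mul_apply, Fin.sum_univ_two, Matrix.trace_fin_two] <;>
    first | ring1 | linear_combination h | linear_combination -h

-- By Cayley–Hamilton, `A² = (tr A) A - 1`.
theorem trace_mul_pow_eq_chebRec {A B : Matrix (Fin 2) (Fin 2) ℝ} (h : A.det = 1) :
    ∀ n, (B * A ^ n).trace = chebRec A.trace B.trace (B * A).trace n
  | 0 => by simp [chebRec]
  | 1 => by simp [chebRec]
  | n + 2 => by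
    rw [chebRec, ← trace_mul_pow_eq_chebRec h (n + 1), ← trace_mul_pow_eq_chebRec h n,
      pow_succ, pow_succ, mul_assoc (A ^ n), Matrix.sq_eq_of_det_eq_one h]
    simp [mul_sub]

theorem traceTriple_eq (lam : ℝ) (a : ℕ → ℕ) (e : ℝ) (k : ℕ) :
    (matrixPair lam a e k).2.trace = traceX lam a k e ∧
    (matrixPair lam a e k).1.trace = traceY lam a k e ∧
    ((matrixPair lam a e k).1 * (matrixPair lam a e k).2).trace = traceZ lam a k e := by
  induction k with
  | zero =>
    simp [matrixPair, traceX, traceY, traceZ, traceTriple, transferStep, Matrix.trace_fin_two]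
    norm_num [sub_eq_add_neg]
  | succ k ih =>
    have hdet := (det_matrixPair lam a e k).2
    rw [traceX_succ, traceY_succ, traceZ_succ, matrixPair]
    simp only
    rw [← ih.1, ← ih.2.1, ← ih.2.2, ← trace_mul_pow_eq_chebRec hdet,
      ← trace_mul_pow_eq_chebRec hdet]
    refine ⟨rfl, rfl, ?_⟩
    rw [Matrix.trace_mul_comm, mul_assoc, ← pow_succ]

section

variable {lam β : ℝ}

/-- The Sturmian potential on `ℕ`. -/
noncomputable def halfPotential (lam β : ℝ) (n : ℕ) : ℝ := sturmianPotential lam β (n : ℤ)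

theorem halfPotential_add_cfDen (hirr : Irrational β) (hβ : β ∈ Set.Icc (0 : ℝ) 1) (k n : ℕ)
    (hn : 1 ≤ n) (hn' : n + 1 < cfDen (cfDigit β) (k + 1)) :
    halfPotential lam β (n + cfDen (cfDigit β) k) = halfPotential lam β n :=
  sturmianPotential_add_cfDen hirr hβ k n hn hn'

/-- Blocks of length `q = cfDen (k + 1)` are split off one by one. The repeated stretch ends at
least `q` sites before `cfDen (k + 2)`, and `q ≥ 2` gives the margin `n + 1 < cfDen (k + 2)`. Small
denominators need direct computation. -/
theorem transferProd_cfDen_step (hirr : Irrational β) (hβ : β ∈ Set.Icc (0 : ℝ) 1) (e : ℝ)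
    (k : ℕ) (hq : 2 ≤ cfDen (cfDigit β) (k + 1)) :
    transferProd (halfPotential lam β) e (cfDen (cfDigit β) (k + 2)) =
      transferProd (halfPotential lam β) e (cfDen (cfDigit β) k) *
        transferProd (halfPotential lam β) e (cfDen (cfDigit β) (k + 1)) ^ cfDigit β k := by
  have key : ∀ j ≤ cfDigit β k,
      transferProd (halfPotential lam β) e
        (cfDen (cfDigit β) k + j * cfDen (cfDigit β) (k + 1)) =
      transferProd (halfPotential lam β) e (cfDen (cfDigit β) k) *
        transferProd (halfPotential lam β) e (cfDen (cfDigit β) (k + 1)) ^ j := by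
    intro j
    induction j with
    | zero => intro _; simp
    | succ j ih =>
      intro hj
      rw [show cfDen (cfDigit β) k + (j + 1) * cfDen (cfDigit β) (k + 1) =
        cfDen (cfDigit β) k + j * cfDen (cfDigit β) (k + 1) + cfDen (cfDigit β) (k + 1) by ring,
        transferProd_add, ih (by omega), pow_succ, mul_assoc]
      intro n hn hn'
      refine halfPotential_add_cfDen hirr hβ (k + 1) n hn ?_
      have : (j + 1) * cfDen (cfDigit β) (k + 1) ≤ cfDigit β k * cfDen (cfDigit β) (k + 1) :=
        Nat.mul_le_mul_right _ hj
      rw [cfDen]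
      nlinarith
  rw [cfDen]
  exact key _ le_rfl

theorem floor_natCast_mul_of_le_digit (hirr : Irrational β) (hβ : β ∈ Set.Icc (0 : ℝ) 1) (n : ℕ)
    (hn : n + 1 ≤ cfDigit β 0) : ⌊((n + 1 : ℕ) : ℝ) * β⌋ = 0 := by
  induction n with
  | zero =>
    rw [zero_add, Nat.cast_one, one_mul]
    exact Int.floor_eq_zero_iff.2 ⟨hβ.1, lt_of_le_of_ne hβ.2 hirr.ne_one⟩
  | succ n ih =>
    have h := floor_add_cfDen_mul hirr hβ 1 (n + 1) (by omega) (by simp [cfDen]; omega)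
    simp only [cfDen, cfNum] at h
    rw [h, ih (by omega)]
    rfl

theorem transferProd_digit_zero (hirr : Irrational β) (hβ : β ∈ Set.Icc (0 : ℝ) 1) (e : ℝ) :
    transferProd (halfPotential lam β) e (cfDigit β 0) =
      transferStep e lam * transferStep e 0 ^ (cfDigit β 0 - 1) := by
  have ha := one_le_cfDigit hirr
  obtain ⟨n, hn⟩ := Nat.exists_eq_add_of_le' (ha 0)
  have hlast : ⌊((n + 1 + 1 : ℕ) : ℝ) * β⌋ = 1 := by
    have h := floor_add_cfDen_mul hirr hβ 2 1 le_rfl (two_le_cfDen ha 0)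
    have h0 := floor_natCast_mul_of_le_digit hirr hβ 0 (ha 0)
    simp only [cfDen, cfNum, hn] at h
    rw [zero_add] at h0
    rw [h0] at h
    rw [← show 1 + (0 + (n + 1) * 1) = n + 1 + 1 by ring, h]
    simp
  rw [hn, transferProd, Nat.add_sub_cancel, transferProd_const (c := 0)]
  · congr 2
    rw [halfPotential, sturmianPotential_natCast, hlast,
      floor_natCast_mul_of_le_digit hirr hβ n hn.ge]
    simp
  · intro i hi hi'
    obtain ⟨j, rfl⟩ := Nat.exists_eq_add_of_le' hi
    rw [halfPotential, sturmianPotential_natCast,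
      floor_natCast_mul_of_le_digit hirr hβ (j + 1) (by omega),
      floor_natCast_mul_of_le_digit hirr hβ j (by omega)]
    simp

theorem floor_natCast_mul_of_digit_eq_one (hirr : Irrational β) (hβ : β ∈ Set.Icc (0 : ℝ) 1)
    (h1 : cfDigit β 0 = 1) (n : ℕ) (hn : n ≤ cfDigit β 1) :
    ⌊((n + 1 : ℕ) : ℝ) * β⌋ = n := by
  induction n with
  | zero => simpa using floor_natCast_mul_of_le_digit hirr hβ 0 h1.ge
  | succ n ih =>
    have h := floor_add_cfDen_mul hirr hβ 2 (n + 1) (by omega) (by simp [cfDen, h1]; omega)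
    simp only [cfDen, cfNum, h1] at h
    rw [ih (by omega)] at h
    simpa using h

theorem transferProd_digit_one (hirr : Irrational β) (hβ : β ∈ Set.Icc (0 : ℝ) 1) (e : ℝ)
    (h1 : cfDigit β 0 = 1) :
    transferProd (halfPotential lam β) e (cfDigit β 1 + 1) =
      transferStep e 0 * transferStep e lam ^ cfDigit β 1 := by
  have ha := one_le_cfDigit hirr
  have hlast : ⌊((cfDigit β 1 + 1 + 1 : ℕ) : ℝ) * β⌋ = cfDigit β 1 := by
    have h := floor_add_cfDen_mul hirr hβ 3 1 le_rfl (two_le_cfDen ha 1)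
    have h0 := floor_natCast_mul_of_le_digit hirr hβ 0 (ha 0)
    simp only [cfDen, cfNum, h1] at h
    rw [zero_add] at h0
    rw [h0] at h
    rw [← show 1 + (1 + cfDigit β 1 * (0 + 1 * 1)) = cfDigit β 1 + 1 + 1 by ring, h]
    simp
  rw [transferProd, transferProd_const (c := lam)]
  · congr 2
    rw [halfPotential, sturmianPotential_natCast, hlast,
      floor_natCast_mul_of_digit_eq_one hirr hβ h1 _ le_rfl]
    simp
  · intro i hi hi'
    obtain ⟨j, rfl⟩ := Nat.exists_eq_add_of_le' hi
    rw [halfPotential, sturmianPotential_natCast,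
      floor_natCast_mul_of_digit_eq_one hirr hβ h1 (j + 1) hi',
      floor_natCast_mul_of_digit_eq_one hirr hβ h1 j (by omega)]
    simp

theorem transferProd_cfDen (hirr : Irrational β) (hβ : β ∈ Set.Icc (0 : ℝ) 1) (e : ℝ) (k : ℕ) :
    transferProd (halfPotential lam β) e (cfDen (cfDigit β) (k + 2)) =
      (matrixPair lam (cfDigit β) e (k + 1)).2 ∧
    transferProd (halfPotential lam β) e (cfDen (cfDigit β) (k + 3)) =
      (matrixPair lam (cfDigit β) e (k + 2)).2 := by
  have ha := one_le_cfDigit hirr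
  have hBA : !![1, -lam; 0, 1] * transferStep e 0 = transferStep e lam := by
    rw [transferStep, transferStep, Matrix.mul_fin_two]
    ext i j
    fin_cases i <;> fin_cases j <;> (simp; try ring)
  induction k with
  | zero =>
    have hfirst : transferProd (halfPotential lam β) e (cfDen (cfDigit β) 2) =
        (matrixPair lam (cfDigit β) e 1).2 := by
      obtain ⟨n, hn⟩ := Nat.exists_eq_add_of_le' (ha 0)
      rw [show cfDen (cfDigit β) 2 = cfDigit β 0 by simp [cfDen],
        transferProd_digit_zero hirr hβ]
      simp only [matrixPair]
      rw [hn, Nat.add_sub_cancel, pow_succ', ← mul_assoc, hBA]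
    refine ⟨hfirst, ?_⟩
    -- If the first digit is 1, the denominator `cfDen 2` is 1 and the general step does not apply.
    rcases (ha 0).eq_or_lt with h1 | h1
    · simp only [matrixPair]
      rw [show cfDen (cfDigit β) (0 + 3) = cfDigit β 1 + 1 by simp [cfDen, ← h1]; ring,
        transferProd_digit_one hirr hβ e h1.symm, ← h1, pow_one, hBA]
    · rw [show (0 : ℕ) + 3 = 1 + 2 by ring,
        transferProd_cfDen_step hirr hβ e 1 (by simp [cfDen]; omega), hfirst]
      conv_rhs => rw [show (0 : ℕ) + 2 = 1 + 1 by ring, matrixPair]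
      simp only [matrixPair]
      congr 1
      rw [show cfDen (cfDigit β) 1 = 0 + 1 from rfl, transferProd, transferProd, mul_one]
      congr 1
      rw [halfPotential, sturmianPotential_natCast,
        floor_natCast_mul_of_le_digit hirr hβ 1 h1,
        floor_natCast_mul_of_le_digit hirr hβ 0 (ha 0)]
      simp
  | succ k ih =>
    refine ⟨ih.2, ?_⟩
    rw [show k + 1 + 3 = k + 2 + 2 by ring,
      transferProd_cfDen_step hirr hβ e (k + 2) (two_le_cfDen ha k), ih.1, ih.2]
    rfl

theorem trace_transferProd_cfDen (hirr : Irrational β) (hβ : β ∈ Set.Icc (0 : ℝ) 1) (e : ℝ)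
    (k : ℕ) : (transferProd (halfPotential lam β) e (cfDen (cfDigit β) (k + 2))).trace =
      traceX lam (cfDigit β) (k + 1) e := by
  rw [(transferProd_cfDen hirr hβ e k).1, (traceTriple_eq lam (cfDigit β) e (k + 1)).1]

end

/-! ### Gordon's argument and membership in the spectrum. -/

theorem det_transferProd (V : ℕ → ℝ) (e : ℝ) (n : ℕ) : (transferProd V e n).det = 1 := by
  induction n with
  | zero => simp [transferProd]
  | succ n ih =>
    rw [transferProd, Matrix.det_mul, ih, transferStep, Matrix.det_fin_two_of]
    ring

theorem transferProd_mulVec {V : ℕ → ℝ} {e : ℝ} {u : ℕ → ℝ}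
    (h : ∀ n, u (n + 2) + u n + V (n + 1) * u (n + 1) = e * u (n + 1)) (n : ℕ) :
    Matrix.mulVec (transferProd V e n) ![u 1, u 0] = ![u (n + 1), u n] := by
  induction n with
  | zero => simp [transferProd]
  | succ n ih =>
    rw [transferProd, ← Matrix.mulVec_mulVec, ih, transferStep]
    ext i
    fin_cases i
    · simp [Matrix.mulVec, dotProduct, Fin.sum_univ_two]
      linear_combination -(h n)
    · simp [Matrix.mulVec, dotProduct, Fin.sum_univ_two]

/-- Gordon's argument: a decaying solution for a potential with arbitrarily long initial squares
and bounded traces vanishes. -/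
theorem eq_zero_of_tendsto_zero_of_gordon {V : ℕ → ℝ} {e : ℝ} {u : ℕ → ℝ}
    (h : ∀ n, u (n + 2) + u n + V (n + 1) * u (n + 1) = e * u (n + 1))
    (hu : Tendsto u atTop (𝓝 0))
    (hq : ∀ N, ∃ q ≥ N, |(transferProd V e q).trace| ≤ 2 ∧ ∀ n, 1 ≤ n → n ≤ q → V (n + q) = V n) :
    u 0 = 0 ∧ u 1 = 0 := by
  have key : ∀ ε > 0, |u 0| ≤ 3 * ε ∧ |u 1| ≤ 3 * ε := by
    intro ε hε
    obtain ⟨N, hN⟩ := Metric.tendsto_atTop.1 hu ε hε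
    have hN' : ∀ n ≥ N, |u n| ≤ ε := fun n hn => by simpa using (hN n hn).le
    obtain ⟨q, hqN, ht, hV⟩ := hq N
    have h1 := transferProd_mulVec h q
    have h2 := transferProd_mulVec h (q + q)
    -- Cayley–Hamilton over the doubled block: the initial vector is `t` times the solution at `q`
    -- minus the solution at `2 q`, hence at most `2 ε + ε`.
    rw [transferProd_add q hV, Matrix.sq_eq_of_det_eq_one (det_transferProd V e q),
      Matrix.sub_mulVec, Matrix.smul_mulVec, h1, Matrix.one_mulVec] at h2
    set t := (transferProd V e q).trace
    have h3 := congr_fun h2 0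
    have h4 := congr_fun h2 1
    simp at h3 h4
    have b : ∀ x, |x| ≤ ε → |t * x| ≤ 2 * ε := fun x hx => by
      rw [abs_mul]
      exact mul_le_mul ht hx (abs_nonneg _) two_pos.le
    have b1 := abs_le.1 (b _ (hN' (q + 1) (by omega)))
    have b2 := abs_le.1 (b _ (hN' q hqN))
    have b3 := abs_le.1 (hN' (q + q + 1) (by omega))
    have b4 := abs_le.1 (hN' (q + q) (by omega))
    constructor <;> rw [abs_le] <;> constructor <;>
      linarith [b1.1, b1.2, b2.1, b2.2, b3.1, b3.2, b4.1, b4.2]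
  constructor <;> rw [← abs_nonpos_iff] <;> refine le_of_forall_pos_le_add fun ε hε => ?_
  · linarith [(key (ε / 3) (by positivity)).1]
  · linarith [(key (ε / 3) (by positivity)).2]

/-- Off the spectrum, the Green function gives decaying solutions of the inhomogeneous equation. -/
theorem exists_green_of_notMem_spectrum {lam β e : ℝ}
    (he : (e : ℂ) ∉ spectrum ℂ (sturmianOperator lam β)) (m : ℤ) :
    ∃ u : ℤ → ℝ, Tendsto u cofinite (𝓝 0) ∧
      ∀ n, u (n + 1) + u (n - 1) + sturmianPotential lam β n * u n - e * u n =
        if n = m then 1 else 0 := by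
  rw [spectrum.notMem_iff] at he
  obtain ⟨G, hG⟩ := he.exists_right_inv
  set ψ : EllTwo := G (-lp.single 2 m (1 : ℂ))
  have h1 : (algebraMap ℂ (EllTwo →L[ℂ] EllTwo) e - sturmianOperator lam β) ψ =
      -lp.single 2 m (1 : ℂ) := by
    have := congr_arg (fun T : EllTwo →L[ℂ] EllTwo => T (-lp.single 2 m (1 : ℂ))) hG
    exact this
  -- Energy, potential and source are real, so the real part solves the equation.
  refine ⟨fun n => (ψ n).re, ?_, fun n => ?_⟩
  · have h2 := (lp.memℓp ψ).summable (by norm_num) |>.tendsto_cofinite_zero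
    refine squeeze_zero_norm (fun n => (Complex.abs_re_le_norm (ψ n))) ?_
    have h3 := h2.rpow_const (p := (1 / 2 : ℝ)) (.inr (by norm_num))
    rw [Real.zero_rpow (by norm_num)] at h3
    refine h3.congr fun n => ?_
    rw [← Real.rpow_mul (norm_nonneg _)]
    norm_num
  · have h2 : ((algebraMap ℂ (EllTwo →L[ℂ] EllTwo) e - sturmianOperator lam β) ψ) n =
        (e : ℂ) * ψ n - sturmianOperator lam β ψ n := rfl
    rw [h1, sturmianOperator, jacobiOperator_apply] at h2
    have h3 : (-lp.single 2 m (1 : ℂ) : EllTwo) n = -(if n = m then 1 else 0) := by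
      rw [lp.coeFn_neg, Pi.neg_apply, lp.single_apply, Pi.single_apply]
    rw [h3] at h2
    have h4 := congr_arg Complex.re h2
    simp at h4
    have h5 : (if n = m then (1 : ℂ) else 0).re = if n = m then 1 else 0 := by
      split_ifs <;> simp
    rw [h5] at h4
    linarith

/-- An energy at which transfer matrices over arbitrarily long initial squares of the potential
have bounded traces lies in the spectrum. -/
theorem mem_spectrum_of_gordon {lam β e : ℝ}
    (hq : ∀ N, ∃ q ≥ N, |(transferProd (halfPotential lam β) e q).trace| ≤ 2 ∧
      ∀ n, 1 ≤ n → n ≤ q → halfPotential lam β (n + q) = halfPotential lam β n) :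
    (e : ℂ) ∈ spectrum ℂ (sturmianOperator lam β) := by
  by_contra hne
  obtain ⟨u, hu, hu'⟩ := exists_green_of_notMem_spectrum hne 0
  obtain ⟨w, hw, hw'⟩ := exists_green_of_notMem_spectrum hne (-1)
  have hcast : Tendsto (fun n : ℕ => (n : ℤ)) atTop cofinite := by
    rw [← Nat.cofinite_eq_atTop]
    exact Nat.cast_injective.tendsto_cofinite
  have hneg : Tendsto (fun n : ℕ => -1 - (n : ℤ)) atTop cofinite := by
    rw [← Nat.cofinite_eq_atTop]
    exact Function.Injective.tendsto_cofinite fun i j h => by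
      simpa using h
  have hvan : ∀ (y : ℤ → ℝ) (m : ℤ), m ≤ 0 → Tendsto y cofinite (𝓝 0) →
      (∀ n, y (n + 1) + y (n - 1) + sturmianPotential lam β n * y n - e * y n =
        if n = m then 1 else 0) → y 0 = 0 ∧ y 1 = 0 := by
    intro y m hm hy hy'
    have := eq_zero_of_tendsto_zero_of_gordon (V := halfPotential lam β) (e := e)
      (u := fun n : ℕ => y n) (fun n => ?_) (hy.comp hcast) hq
    · simpa using this
    · have h := hy' (n + 1)
      rw [if_neg (by omega)] at h
      simp only [halfPotential]
      push_cast
      rw [show (n : ℤ) + 1 + 1 = n + 2 by ring, show (n : ℤ) + 1 - 1 = n by ring] at h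
      linarith
  -- Gordon kills both Green functions at 0 and 1. To the left of both sources their Wronskian is
  -- then constantly 1, against decay at minus infinity.
  obtain ⟨u0, u1⟩ := hvan u 0 le_rfl hu hu'
  obtain ⟨w0, w1⟩ := hvan w (-1) (by norm_num) hw hw'
  have um1 : u (-1) = 1 := by
    have := hu' 0
    simp [u0, u1] at this
    exact this
  have wm1 : w (-1) = 0 := by
    have := hw' 0
    simp [w0, w1] at this
    exact this
  have wm2 : w (-2) = 1 := by
    have := hw' (-1)
    simp [w0, wm1] at this
    exact this
  have hW : ∀ n : ℕ, u (-1 - n) * w (-1 - n - 1) - u (-1 - n - 1) * w (-1 - n) = 1 := by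
    intro n
    induction n with
    | zero => simp [um1, wm1, wm2]
    | succ n ih =>
      have e1 := hu' (-1 - n - 1)
      have e2 := hw' (-1 - n - 1)
      rw [if_neg (by omega)] at e1 e2
      rw [sub_add_cancel] at e1 e2
      push_cast
      rw [show (-1 : ℤ) - (n + 1) = -1 - n - 1 by ring]
      linear_combination ih - w (-1 - n - 1) * e1 + u (-1 - n - 1) * e2
  have hneg' : Tendsto (fun n : ℕ => -1 - (n : ℤ) - 1) atTop cofinite := by
    rw [← Nat.cofinite_eq_atTop]
    exact Function.Injective.tendsto_cofinite fun i j h => by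
      simpa using h
  have hlim := ((hu.comp hneg).mul (hw.comp hneg')).sub ((hu.comp hneg').mul (hw.comp hneg))
  have := tendsto_nhds_unique hlim (tendsto_const_nhds.congr fun n => (hW n).symm)
  norm_num at this

theorem mem_spectrum_of_bounded_traces {lam β e : ℝ} (hirr : Irrational β)
    (hβ : β ∈ Set.Icc (0 : ℝ) 1) (k : ℕ)
    (h : ∀ j, |traceX lam (cfDigit β) (k + j) e| ≤ 2 ∨
      |traceX lam (cfDigit β) (k + j + 1) e| ≤ 2) :
    (e : ℂ) ∈ spectrum ℂ (sturmianOperator lam β) := by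
  have ha := one_le_cfDigit hirr
  refine mem_spectrum_of_gordon fun N => ?_
  -- `i ≥ 2` makes `cfDen (i + 1) ≥ 2`, so the whole block of length `cfDen (i + 2)` is repeated.
  obtain ⟨i, hi, hX⟩ : ∃ i ≥ N + 2, |traceX lam (cfDigit β) (i + 1) e| ≤ 2 := by
    rcases h (N + 3) with h | h
    · exact ⟨k + N + 2, by omega, h⟩
    · exact ⟨k + N + 3, by omega, h⟩
  refine ⟨cfDen (cfDigit β) (i + 2), ?_, ?_, fun n hn hn' => ?_⟩
  · have := le_cfDen ha (i + 1)
    exact le_trans (by omega) this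
  · rwa [trace_transferProd_cfDen hirr hβ]
  · refine halfPotential_add_cfDen hirr hβ (i + 2) n hn ?_
    obtain ⟨j, rfl⟩ := Nat.exists_eq_add_of_le' (show 2 ≤ i by omega)
    have h1 := cfDen_add_le ha (j + 3)
    have h2 := two_le_cfDen ha j
    have h3 : n ≤ cfDen (cfDigit β) (j + 3 + 1) := hn'
    exact lt_of_lt_of_le (by omega) h1

/-! ### Covering numbers and the dimension bound. -/

/-- Disjoint intervals of length at least `ε`, each meeting `S`, force a large covering number. -/
theorem le_externalCoveringNumber_of_disjoint_intervals {S : Set ℂ} {ε : ℝ≥0}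
    (F : Finset (ℝ × ℝ)) (hF : (F : Set (ℝ × ℝ)).PairwiseDisjoint (fun I => Set.Icc I.1 I.2))
    (h : ∀ I ∈ F, I.1 + ε ≤ I.2 ∧ ∃ e ∈ Set.Icc I.1 I.2, (e : ℂ) ∈ S) :
    (((F.card + 1) / 2 : ℕ) : ℕ∞) ≤ Metric.externalCoveringNumber (ε / 2) S := by
  classical
  refine le_iInf₂ fun C hC => ?_
  rcases C.finite_or_infinite with hfin | hinf
  swap
  · rw [hinf.encard_eq]; exact le_top
  rw [hfin.encard_eq_coe_toFinset_card, Nat.cast_le]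
  choose! p hp hpS using fun I hI => (h I hI).2
  have hcov : ∀ I ∈ F, ∃ c ∈ C, |p I - c.re| ≤ ε / 2 := by
    intro I hI
    have := Metric.isCover_iff_subset_iUnion_closedBall.1 hC (hpS I hI)
    simp only [Set.mem_iUnion, exists_prop] at this
    obtain ⟨c, hc, hd⟩ := this
    refine ⟨c, hc, ?_⟩
    rw [Metric.mem_closedBall, dist_eq_norm] at hd
    have h2 := (Complex.abs_re_le_norm _).trans hd
    simpa using h2
  choose! c hc hpc using hcov
  -- If three intervals met one ball, the middle one, of length at least `ε`, would lie strictly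
  -- between two points at distance at most `ε`.
  have hcard : F.card ≤ 2 * hfin.toFinset.card := by
    refine Finset.card_le_mul_card_image_of_maps_to (f := c)
      (fun I hI => hfin.mem_toFinset.2 (hc I hI)) 2 fun b _ => ?_
    by_contra! hlt
    obtain ⟨A, hA, B, hB, D, hD, hAB, hAD, hBD⟩ := Finset.two_lt_card.1 hlt
    simp only [Finset.mem_filter] at hA hB hD
    have hε : (0 : ℝ) ≤ ε := ε.coe_nonneg
    have order : ∀ I ∈ F, ∀ J ∈ F, I ≠ J → I.2 < J.1 ∨ J.2 < I.1 := by
      intro I hI J hJ hIJ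
      by_contra! hc
      have h1 := (h I hI).1
      have h2 := (h J hJ).1
      have m1 : max I.1 J.1 ∈ Set.Icc I.1 I.2 := ⟨le_max_left _ _, max_le (by linarith) hc.1⟩
      have m2 : max I.1 J.1 ∈ Set.Icc J.1 J.2 := ⟨le_max_right _ _, max_le hc.2 (by linarith)⟩
      exact Set.disjoint_left.1 (hF hI hJ hIJ) m1 m2
    have bA := abs_le.1 (hpc A hA.1)
    have bB := abs_le.1 (hpc B hB.1)
    have bD := abs_le.1 (hpc D hD.1)
    rw [hA.2] at bA
    rw [hB.2] at bB
    rw [hD.2] at bD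
    have mA := hp A hA.1
    have mB := hp B hB.1
    have mD := hp D hD.1
    have lA := (h A hA.1).1
    have lB := (h B hB.1).1
    have lD := (h D hD.1).1
    rcases order A hA.1 B hB.1 hAB with h1 | h1 <;>
    rcases order A hA.1 D hD.1 hAD with h2 | h2 <;>
    rcases order B hB.1 D hD.1 hBD with h3 | h3 <;>
    linarith [mA.1, mA.2, mB.1, mB.2, mD.1, mD.2, bA.1, bA.2, bB.1, bB.2, bD.1, bD.2]
  omega

theorem logMean_eq {β : ℝ} (hirr : Irrational β) (n : ℕ) :
    logMean β n = 3 / n * ∑ i ∈ Finset.range n, Real.log (cfDigit β i + 2) := by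
  have h := Finset.sum_Ico_add' (fun j => Real.log (partialQuotient β j + 2)) 0 n 1
  have e : Finset.Icc 1 n = Finset.Ico (0 + 1) (n + 1) := by ext; simp
  rw [logMean, e, ← h, Finset.range_eq_Ico]
  simp only [partialQuotient_succ hirr]

/-- Bands are counted from level 1, whereas `logMean` starts at the first digit; the missing level 0
term is nonnegative. -/
theorem sum_log_stepCost_le {lam β : ℝ} (hlam : 20 < lam) (hirr : Irrational β) (m : ℕ) :
    ∑ i ∈ Finset.range m, Real.log (stepCost lam (cfDigit β) (1 + i)) ≤
      (m + 1) * (logMean β (m + 1) + Real.log (lam + 5)) := by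
  have hstep : ∀ i, Real.log (stepCost lam (cfDigit β) i) =
      3 * Real.log (cfDigit β i + 2) + Real.log (lam + 5) := by
    intro i
    rw [stepCost, Real.log_mul (by positivity) (by linarith), Real.log_pow]
    norm_num
  have h0 : 0 ≤ Real.log (stepCost lam (cfDigit β) 0) := Real.log_nonneg (stepCost_pos hlam _ _)
  calc _ ≤ ∑ i ∈ Finset.range (m + 1), Real.log (stepCost lam (cfDigit β) i) := by
        rw [Finset.sum_range_succ']
        simp only [add_comm 1]
        linarith
    _ = _ := by
        simp only [hstep]
        rw [Finset.sum_add_distrib, ← Finset.mul_sum, logMean_eq hirr]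
        simp only [Finset.sum_const, Finset.card_range, nsmul_eq_mul]
        push_cast
        field_simp

open Real in
/-- Finite-scale lower bound for the covering numbers of the spectrum. -/
theorem exists_covering_bound {lam β : ℝ} (hlam : 20 < lam) (hβ : β ∈ Set.Icc (0 : ℝ) 1)
    (hirr : Irrational β) : ∃ D : ℝ, 0 < D ∧ ∀ (m : ℕ) (ε : ℝ≥0),
      (ε : ℝ) = 4 / ((∏ i ∈ Finset.range m, stepCost lam (cfDigit β) (1 + i)) * D) →
      ENNReal.ofReal (goldenRatio ^ m / 2) ≤
        ((Metric.externalCoveringNumber (ε / 2) (spectrum ℂ (sturmianOperator lam β)) : ℕ∞) :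
          ℝ≥0∞) := by
  have ha := one_le_cfDigit hirr
  -- The initial band `[lam - 2, lam + 2]` has type I; its type II child at level 1 is used because
  -- the golden ratio count starts from type II. Its cost only enters the constant `D`.
  obtain ⟨u, v, -, -, b⟩ := exists_typeII_of_typeI hlam (ha 0) (isBand_zero lam (cfDigit β))
  refine ⟨(lam + 9) ^ (cfDigit β 0 - 1) * 1, ?_, fun m ε hε => ?_⟩
  · have : 0 < lam + 9 := by linarith
    positivity
  set D := (lam + 9) ^ (cfDigit β 0 - 1) * 1
  obtain ⟨F, hcard, hdisj, hF⟩ := b.packs_desc hlam ha m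
  have hN := le_externalCoveringNumber_of_disjoint_intervals (ε := ε)
    (S := spectrum ℂ (sturmianOperator lam β))
    F hdisj fun I hI => by
      obtain ⟨hI1, -, -, τ, hb⟩ := hF I hI
      constructor
      · have h4 := hb.four_le
        have hlt := hb.lt
        rw [zero_add] at h4
        rw [hε, ← le_sub_iff_add_le', div_le_iff₀]
        · linarith
        · by_contra! hneg
          nlinarith
      · obtain ⟨e, he, hbd⟩ := hb.exists_bounded hlam ha
        exact ⟨e, he, mem_spectrum_of_bounded_traces hirr hβ _ hbd⟩
  have hg := goldenRatio_pow_le_descCount ha m 1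
  rw [zero_add] at hcard
  rw [hcard] at hN
  have h1 : ENNReal.ofReal (goldenRatio ^ m / 2) ≤
      (((descCount (cfDigit β) m 1 .II + 1) / 2 : ℕ) : ℝ≥0∞) := by
    refine ENNReal.ofReal_le_of_le_toReal ?_
    rw [ENNReal.toReal_natCast, div_le_iff₀ two_pos]
    refine hg.trans ?_
    have : descCount (cfDigit β) m 1 .II ≤ (descCount (cfDigit β) m 1 .II + 1) / 2 * 2 := by omega
    exact_mod_cast this
  refine h1.trans ?_
  exact_mod_cast (ENat.toENNReal_le.2 hN)

theorem two_pow_le_prod_stepCost {lam : ℝ} (hlam : 20 < lam) (a : ℕ → ℕ) (m : ℕ) :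
    2 ^ m ≤ ∏ i ∈ Finset.range m, stepCost lam a (1 + i) := by
  rw [← Finset.card_range m, ← Finset.prod_const, Finset.card_range]
  refine Finset.prod_le_prod (fun _ _ => by norm_num) fun i _ => ?_
  rw [stepCost]
  nlinarith [one_le_pow₀ (show (1 : ℝ) ≤ a (1 + i) + 2 by
    linarith [(a (1 + i)).cast_nonneg (α := ℝ)]) (n := 3)]

open Real in
theorem le_upperBoxDim_of_lt {lam β C θ : ℝ} (hlam : 20 < lam) (hβ : β ∈ Set.Icc (0 : ℝ) 1)
    (hirr : Irrational β) (hC : ∀ η > 0, ∀ᶠ k in atTop, logMean β k < C + η)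
    (hθ : 0 < θ) (hθ' : θ * (C + Real.log (lam + 5)) < Real.log goldenRatio) :
    (θ : EReal) ≤ upperBoxDim (spectrum ℂ (sturmianOperator lam β)) := by
  obtain ⟨D, hD, hcov⟩ := exists_covering_bound hlam hβ hirr
  set K : ℕ → ℝ := fun m => ∏ i ∈ Finset.range m, stepCost lam (cfDigit β) (1 + i) with hK
  have hK2 : ∀ m, 2 ^ m ≤ K m := two_pow_le_prod_stepCost hlam _
  have hKpos : ∀ m, 0 < K m := fun m => lt_of_lt_of_le (by positivity) (hK2 m)
  have hKtop : Tendsto K atTop atTop :=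
    tendsto_atTop_mono hK2 (tendsto_pow_atTop_atTop_of_one_lt one_lt_two)
  have hε0 : ∀ m, 0 < 4 / (K m * D) := fun m => by have := hKpos m; positivity
  set ε : ℕ → ℝ≥0 := fun m => ⟨4 / (K m * D), (hε0 m).le⟩
  have hεr : ∀ m, (ε m : ℝ) = 4 / (K m * D) := fun _ => rfl
  have hεpos : ∀ m, 0 < ε m := fun m => by exact_mod_cast hε0 m
  have hreal : Tendsto (fun m => 4 / (K m * D)) atTop (𝓝 0) :=
    (hKtop.atTop_mul_const hD).const_div_atTop 4
  have hlim : Tendsto ε atTop (𝓝[>] 0) := by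
    refine tendsto_nhdsWithin_iff.2 ⟨?_, Eventually.of_forall hεpos⟩
    rw [← NNReal.tendsto_coe]
    exact hreal
  -- A limsup is bounded below along one sequence of scales tending to 0.
  refine le_limsup_of_frequently_le (hlim.frequently (Eventually.frequently ?_))
  obtain ⟨η, hη, hη'⟩ : ∃ η > 0, θ * (C + η + Real.log (lam + 5)) < Real.log goldenRatio := by
    refine ⟨(Real.log goldenRatio - θ * (C + Real.log (lam + 5))) / (2 * θ),
      div_pos (sub_pos.2 hθ') (by positivity), ?_⟩
    have : θ * ((Real.log goldenRatio - θ * (C + Real.log (lam + 5))) / (2 * θ)) =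
        (Real.log goldenRatio - θ * (C + Real.log (lam + 5))) / 2 := by field_simp
    linarith
  have hsmall : ∀ᶠ m in atTop, 4 / (K m * D) < 1 := hreal.eventually_lt_const one_pos
  -- The slack left by `η` makes the right side grow linearly, absorbing `D`, the extra level and
  -- the factor 2.
  have hlin : ∀ᶠ m : ℕ in atTop,
      θ * (Real.log (D / 4) + (C + η + Real.log (lam + 5))) + Real.log 2 ≤
      m * (Real.log goldenRatio - θ * (C + η + Real.log (lam + 5))) :=
    (tendsto_natCast_atTop_atTop.atTop_mul_const (sub_pos.2 hη')).eventually_ge_atTop _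
  filter_upwards [hsmall, hlin, (tendsto_add_atTop_nat 1).eventually (hC η hη)] with m h1 h2 h3
  have hlogpos : 0 < -Real.log (ε m : ℝ) := by
    have := Real.log_neg (hε0 m) h1
    rw [hεr]
    linarith
  have hlogle : -Real.log (ε m : ℝ) ≤
      Real.log (D / 4) + (m + 1) * (C + η + Real.log (lam + 5)) := by
    have h4 := sum_log_stepCost_le hlam hirr m
    rw [← Real.log_prod fun i _ =>
      (lt_of_lt_of_le one_pos (stepCost_pos hlam (cfDigit β) (1 + i))).ne'] at h4
    have h5 : -Real.log (ε m : ℝ) = Real.log (D / 4) + Real.log (K m) := by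
      rw [hεr, ← Real.log_inv, ← Real.log_mul (by positivity) (hKpos m).ne']
      congr 1
      field_simp
    rw [h5]
    have h6 : ((m : ℝ) + 1) * (logMean β (m + 1) + Real.log (lam + 5)) ≤
        (m + 1) * (C + η + Real.log (lam + 5)) := by gcongr
    linarith
  rw [EReal.le_div_iff_mul_le (by exact_mod_cast hlogpos) (EReal.coe_ne_top _)]
  have h7 := ENNReal.log_le_log (hcov m (ε m) rfl)
  have hg : 0 < goldenRatio ^ m / 2 := by have := goldenRatio_pos; positivity
  rw [ENNReal.log_ofReal, if_neg (not_le.2 hg)] at h7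
  refine le_trans ?_ h7
  rw [← EReal.coe_mul, EReal.coe_le_coe_iff, Real.log_div (by have := goldenRatio_pos; positivity)
    two_ne_zero, Real.log_pow]
  have h8 := mul_le_mul_of_nonneg_left hlogle hθ.le
  linarith

theorem theorem5 (lam β C : ℝ) (hlam : 20 < lam) (hβ : β ∈ Set.Icc (0 : ℝ) 1)
    (hirr : Irrational β)
    (hC : Filter.limsup (fun k : ℕ => ((logMean β k : ℝ) : EReal)) Filter.atTop = (C : EReal)) :
    ((Real.log ((Real.sqrt 5 + 1) / 2) / (C + Real.log (lam + 5)) : ℝ) : EReal)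
      ≤ upperBoxDim (spectrum ℂ (sturmianOperator lam β)) := by
  have hC' : ∀ η > 0, ∀ᶠ k in atTop, logMean β k < C + η := by
    intro η hη
    have : limsup (fun k : ℕ => ((logMean β k : ℝ) : EReal)) atTop < ((C + η : ℝ) : EReal) := by
      rw [hC, EReal.coe_lt_coe_iff]; linarith
    filter_upwards [eventually_lt_of_limsup_lt this] with k hk
    exact_mod_cast hk
  have hC0 : 0 ≤ C := by
    refine le_of_forall_pos_le_add fun η hη => ?_
    obtain ⟨k, hk⟩ := (hC' η hη).exists
    refine le_trans ?_ hk.le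
    rw [logMean_eq hirr]
    refine mul_nonneg (by positivity) (Finset.sum_nonneg fun i _ => Real.log_nonneg ?_)
    linarith [(cfDigit β i).cast_nonneg (α := ℝ)]
  have hL : 0 < Real.log (lam + 5) := Real.log_pos (by linarith)
  have hφ : Real.log ((Real.sqrt 5 + 1) / 2) = Real.log Real.goldenRatio := by
    rw [Real.goldenRatio, add_comm]
  rw [hφ]
  have hpos : 0 < Real.log Real.goldenRatio := Real.log_pos Real.one_lt_goldenRatio
  set T := Real.log Real.goldenRatio / (C + Real.log (lam + 5)) with hT
  have hTpos : 0 < T := by positivity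
  by_contra! hlt
  obtain ⟨z, hz1, hz2⟩ := EReal.lt_iff_exists_real_btwn.1 hlt
  have hzT : z < T := by exact_mod_cast hz2
  -- The maximum with `T / 2` keeps the exponent positive, as `z` may be negative.
  have hmax : max z (T / 2) < T := max_lt hzT (by linarith)
  have := le_upperBoxDim_of_lt hlam hβ hirr hC' (θ := max z (T / 2))
    (lt_max_of_lt_right (by positivity)) ((lt_div_iff₀ (by positivity)).1 hmax)
  refine absurd (this.trans_lt hz1) (not_lt.2 ?_)
  exact_mod_cast le_max_left z (T / 2)
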